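/- Let $A$ be an associative ring with unit and $\mathfrak C$ an $A$-coring (a comonoid $(\mathfrak C,\Delta,\varepsilon)$ in the category of $A$-bimodules, $\Delta(c)=c_{(1)}\otimes_A c_{(2)}$). Let ${}^*\mathfrak C={}_A\mathrm{Hom}(\mathfrak C,A)$ with multiplication $(f*g)(c)=g(c_{(1)}f(c_{(2)}))$ and right $A$-action $(fa)(c)=f(c)a$. Let $\mathrm{Rat}({}^*\mathfrak C)$ be the largest right $A$-submodule of ${}^*\mathfrak C$ that has a right $\mathfrak C$-comodule structure $f\mapsto f_{[0]}\otimes_A f_{[1]}$ with $f*g=f_{[0]}\,g(f_{[1]})$ for all $g\in{}^*\mathfrak C$. Suppose that * $\mathfrak C$ is weakly locally projective as a left $A$-module, i.e. for every left $A$-linear $f:\mathfrak C\to N$, every surjective left $A$-linear $g:M\to N$ and every finitely generated submodule $E\subset\mathfrak C$ there is a left $A$-linear $h:\mathfrak C\to M$ with $g\circ h|_E=f|_E$; * $\mathrm{Rat}({}^*\mathfrak C)$ is dense in ${}^*\mathfrak C$ for the finite topology (the topology of pointwise convergence, $A$ being discrete). Let $\Sigma$ be a right $\mathfrak C$-comodule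 with coaction $x\mapsto x_{[0]}\otimes_A x_{[1]}$, and let $T=\mathrm{End}^{\mathfrak C}(\Sigma)$ be its ring of $\mathfrak C$-colinear endomorphisms, acting on $\Sigma$ from the left. Let $R$ be a firm ring, i.e. a ring, not necessarily with unit, whose multiplication induces a bijection $R\otimes_R R\to R$. Let $\iota:R\to T$ be an injective ring morphism whose image is a right ideal of $T$ (so $R$ is a right ideal in $T$), and suppose that $\Sigma$ is firm as a left $R$-module through $\iota$, i.e. $R\otimes_R\Sigma\to\Sigma$, $r\otimes x\mapsto \iota(r)(x)$, is bijective. All right $R$-module structures below are by composition with $\iota(r)$. Let $\mathcal M^{\mathfrak C}$ be the category of right $\mathfrak C$-comodules, $\mathcal M_R$ the category of firm right $R$-modules ($M\otimes_RR\to M$ bijective), and let $Q$ be the right $R$-module of all right $A$-linear maps $q:\Sigma\to{}^*\mathfrak C$ with $q(x_{[0]})(c)\,x_{[1]}=c_{(1)}\,q(x)(c_{(2)})$ for all $x\in\Sigma$, $c\in\mathfrak C$; such $q$ take values in $\mathrm{Rat}({}^*\mathfrak C)$. Then the following statements are equivalent: 1. $\Sigma$ is a generator in $\mathcal M^{\mathfrak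 C}$; 2. $\Sigma$ is flat as a left $R$-module, i.e. $-\otimes_R\Sigma$ is left exact on the category of all (not necessarily firm) right $R$-modules, and $\Sigma$ is an $R$-comonadic Galois comodule, i.e. for every right $A$-module $M$ the map $\mathrm{Hom}_A(\Sigma,M)\otimes_R\Sigma\to M\otimes_A\mathfrak C$, $\phi\otimes x\mapsto\phi(x_{[0]})\otimes x_{[1]}$, is bijective; 3. the functor $\mathrm{Hom}^{\mathfrak C}(\Sigma,-)\otimes_R R:\mathcal M^{\mathfrak C}\to\mathcal M_R$ is fully faithful; 4. the map $Q\otimes_R\Sigma\to\mathrm{Rat}({}^*\mathfrak C)$, $q\otimes x\mapsto q(x)$, is surjective. -/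

import Mathlib

open CategoryTheory MulOpposite
open scoped TensorProduct

universe u

/-! Balanced tensor products over a ring that need be neither commutative nor unital.
A right action of `R` on `M` is written as an action of `Rᵐᵒᵖ`, so `op r • m` is `m · r`. -/

/-- The subgroup of `M ⊗[ℤ] N` generated by the elements `m · r ⊗ n - m ⊗ r · n`. -/
def balancedRel (R M N : Type u) [AddCommGroup M] [AddCommGroup N] [SMul Rᵐᵒᵖ M] [SMul R N] :
    AddSubgroup (M ⊗[ℤ] N) :=
  AddSubgroup.closure
    {t | ∃ (m : M) (r : R) (n : N), t = (op r • m) ⊗ₜ[ℤ] n - m ⊗ₜ[ℤ] (r • n)}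

/-- The tensor product `M ⊗_R N` of a right `R`-module `M` and a left `R`-module `N`. -/
def BTensor (R M N : Type u) [AddCommGroup M] [AddCommGroup N] [SMul Rᵐᵒᵖ M] [SMul R N] :
    Type u :=
  (M ⊗[ℤ] N) ⧸ balancedRel R M N

namespace BTensor

section Basic

variable {R M N P : Type u} [AddCommGroup M] [AddCommGroup N] [AddCommGroup P]
  [SMul Rᵐᵒᵖ M] [SMul R N]

instance : AddCommGroup (BTensor R M N) :=
  QuotientAddGroup.Quotient.addCommGroup (balancedRel R M N)

/-- The elementary tensor `m ⊗ n`. -/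
def tmul (R : Type u) {M N : Type u} [AddCommGroup M] [AddCommGroup N] [SMul Rᵐᵒᵖ M] [SMul R N]
    (m : M) (n : N) : BTensor R M N :=
  QuotientAddGroup.mk' (balancedRel R M N) (m ⊗ₜ[ℤ] n)

theorem add_tmul (m m' : M) (n : N) : tmul R (m + m') n = tmul R m n + tmul R m' n := by
  simp only [tmul, TensorProduct.add_tmul, map_add]
  rfl

theorem tmul_add (m : M) (n n' : N) : tmul R m (n + n') = tmul R m n + tmul R m n' := by
  simp only [tmul, TensorProduct.tmul_add, map_add]
  rfl

theorem smul_tmul (r : R) (m : M) (n : N) : tmul R (op r • m) n = tmul R m (r • n) := by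
  refine (QuotientAddGroup.eq_iff_sub_mem).2 ?_
  exact AddSubgroup.subset_closure ⟨m, r, n, rfl⟩

/-- The biadditive map `(m, n) ↦ m ⊗ n`. -/
def mk (R M N : Type u) [AddCommGroup M] [AddCommGroup N] [SMul Rᵐᵒᵖ M] [SMul R N] :
    M →+ N →+ BTensor R M N :=
  AddMonoidHom.mk' (fun m => AddMonoidHom.mk' (fun n => tmul R m n) (tmul_add m))
    (fun m m' => by ext n; exact add_tmul m m' n)

@[simp] theorem mk_apply (m : M) (n : N) : mk R M N m n = tmul R m n := rfl

@[elab_as_elim]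
theorem induction_on {p : BTensor R M N → Prop} (t : BTensor R M N)
    (h0 : p 0) (h1 : ∀ m n, p (tmul R m n)) (h2 : ∀ s t, p s → p t → p (s + t)) : p t := by
  obtain ⟨t, rfl⟩ := QuotientAddGroup.mk'_surjective (balancedRel R M N) t
  induction t using TensorProduct.induction_on with
  | zero => rw [map_zero]; exact h0
  | tmul m n => exact h1 m n
  | add x y hx hy => rw [map_add]; exact h2 _ _ hx hy

theorem hom_ext {f g : BTensor R M N →+ P} (h : ∀ m n, f (tmul R m n) = g (tmul R m n)) :
    f = g := by
  ext t
  refine induction_on t (by rw [map_zero, map_zero]) h ?_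
  intro s t hs ht
  simp [hs, ht]

/-- The additive map out of `M ⊗_R N` induced by a balanced biadditive map. -/
def lift (f : M →+ N →+ P) (h : ∀ m (r : R) n, f (op r • m) n = f m (r • n)) :
    BTensor R M N →+ P :=
  QuotientAddGroup.lift (balancedRel R M N)
    (TensorProduct.liftAddHom f (fun k m n => by simp))
    (by
      refine (AddSubgroup.closure_le _).2 ?_
      rintro _ ⟨m, r, n, rfl⟩
      simp [h])

@[simp] theorem lift_tmul (f : M →+ N →+ P) (h : ∀ m (r : R) n, f (op r • m) n = f m (r • n))
    (m : M) (n : N) : lift f h (tmul R m n) = f m n :=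
  TensorProduct.liftAddHom_tmul (R := ℤ) f (fun k m n => by simp) m n

end Basic

section Functoriality

variable {R M M' N N' : Type u} [AddCommGroup M] [AddCommGroup M'] [AddCommGroup N]
  [AddCommGroup N'] [SMul Rᵐᵒᵖ M] [SMul Rᵐᵒᵖ M'] [SMul R N] [SMul R N']

/-- `f ⊗_R N` for a right `R`-linear `f : M → M'`. -/
def rTensor (N : Type u) [AddCommGroup N] [SMul R N] (f : M →+ M')
    (hf : ∀ (r : R) m, f (op r • m) = op r • f m) : BTensor R M N →+ BTensor R M' N :=
  lift ((mk R M' N).comp f) (fun m r n => by simp [hf, smul_tmul])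

@[simp] theorem rTensor_tmul (f : M →+ M') (hf : ∀ (r : R) m, f (op r • m) = op r • f m)
    (m : M) (n : N) : rTensor N f hf (tmul R m n) = tmul R (f m) n :=
  lift_tmul _ _ m n

/-- `M ⊗_R g` for a left `R`-linear `g : N → N'`. -/
def lTensor (M : Type u) [AddCommGroup M] [SMul Rᵐᵒᵖ M] (g : N →+ N')
    (hg : ∀ (r : R) n, g (r • n) = r • g n) : BTensor R M N →+ BTensor R M N' :=
  lift ((AddMonoidHom.compHom.flip g).comp (mk R M N'))
    (fun m r n => by simp [hg, smul_tmul])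

@[simp] theorem lTensor_tmul (g : N →+ N') (hg : ∀ (r : R) n, g (r • n) = r • g n)
    (m : M) (n : N) : lTensor M g hg (tmul R m n) = tmul R m (g n) :=
  lift_tmul _ _ m n

end Functoriality

section Actions

variable {R M N : Type u} [AddCommGroup M] [AddCommGroup N]

/-- If `N` is a bimodule, then `M ⊗_R N` has the right action `(m ⊗ n) · r = m ⊗ n · r`. -/
instance rightAction [SMul Rᵐᵒᵖ M] [SMul R N] [DistribSMul Rᵐᵒᵖ N] [SMulCommClass R Rᵐᵒᵖ N] :
    DistribSMul Rᵐᵒᵖ (BTensor R M N) where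
  smul s := lTensor M (DistribSMul.toAddMonoidHom N s) (fun r n => (smul_comm r s n).symm)
  smul_zero s := map_zero (lTensor M (DistribSMul.toAddMonoidHom N s) _)
  smul_add s := map_add (lTensor M (DistribSMul.toAddMonoidHom N s) _)

@[simp] theorem op_smul_tmul [SMul Rᵐᵒᵖ M] [SMul R N] [DistribSMul Rᵐᵒᵖ N]
    [SMulCommClass R Rᵐᵒᵖ N] (s : Rᵐᵒᵖ) (m : M) (n : N) :
    s • tmul R m n = tmul R m (s • n) :=
  lTensor_tmul (DistribSMul.toAddMonoidHom N s) (fun r n => (smul_comm r s n).symm) m n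

/-- If `M` is a bimodule, then `M ⊗_R N` has the left action `r · (m ⊗ n) = r · m ⊗ n`. -/
instance leftAction [SMul Rᵐᵒᵖ M] [DistribSMul R M] [SMulCommClass R Rᵐᵒᵖ M] [SMul R N] :
    DistribSMul R (BTensor R M N) where
  smul s := rTensor N (DistribSMul.toAddMonoidHom M s) (fun r m => smul_comm s (op r) m)
  smul_zero s := map_zero (rTensor N (DistribSMul.toAddMonoidHom M s) _)
  smul_add s := map_add (rTensor N (DistribSMul.toAddMonoidHom M s) _)

@[simp] theorem left_smul_tmul [SMul Rᵐᵒᵖ M] [DistribSMul R M] [SMulCommClass R Rᵐᵒᵖ M]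
    [SMul R N] (s : R) (m : M) (n : N) : s • tmul R m n = tmul R (s • m) n :=
  rTensor_tmul (DistribSMul.toAddMonoidHom M s) (fun r m => smul_comm s (op r) m) m n

instance rightModule {A M N : Type u} [Ring A] [AddCommGroup M] [AddCommGroup N]
    [Module Aᵐᵒᵖ M] [Module A N] [Module Aᵐᵒᵖ N] [SMulCommClass A Aᵐᵒᵖ N] :
    Module Aᵐᵒᵖ (BTensor A M N) where
  one_smul t := by
    refine induction_on t (smul_zero _) (by simp) ?_
    intro s t hs ht
    rw [smul_add, hs, ht]
  mul_smul a b t := by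
    refine induction_on t (by simp only [smul_zero]) (by simp [mul_smul]) ?_
    intro s t hs ht
    rw [smul_add, hs, ht, smul_add, smul_add]
  smul_zero := smul_zero
  smul_add := smul_add
  add_smul a b t := by
    refine induction_on t (by simp only [smul_zero, add_zero])
      (by simp [add_smul, tmul_add]) ?_
    intro s t hs ht
    rw [smul_add, hs, ht, smul_add, smul_add]; abel
  zero_smul t := by
    refine induction_on t (smul_zero _) ?_ ?_
    · intro m n
      rw [op_smul_tmul, zero_smul]
      exact map_zero (mk A M N m)
    · intro s t hs ht
      rw [smul_add, hs, ht, add_zero]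

instance leftModule {A M N : Type u} [Ring A] [AddCommGroup M] [AddCommGroup N]
    [Module Aᵐᵒᵖ M] [Module A M] [SMulCommClass A Aᵐᵒᵖ M] [Module A N] :
    Module A (BTensor A M N) where
  one_smul t := by
    refine induction_on t (smul_zero _) (by simp) ?_
    intro s t hs ht
    rw [smul_add, hs, ht]
  mul_smul a b t := by
    refine induction_on t (by simp only [smul_zero]) (by simp [mul_smul]) ?_
    intro s t hs ht
    rw [smul_add, hs, ht, smul_add, smul_add]
  smul_zero := smul_zero
  smul_add := smul_add
  add_smul a b t := by
    refine induction_on t (by simp only [smul_zero, add_zero])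
      (by simp [add_smul, add_tmul]) ?_
    intro s t hs ht
    rw [smul_add, hs, ht, smul_add, smul_add]; abel
  zero_smul t := by
    refine induction_on t (smul_zero _) ?_ ?_
    · intro m n
      rw [left_smul_tmul, zero_smul]
      exact DFunLike.congr_fun (map_zero (mk A M N)) n
    · intro s t hs ht
      rw [smul_add, hs, ht, add_zero]

end Actions

section Assoc

variable {R M B N : Type u} [AddCommGroup M] [AddCommGroup B] [AddCommGroup N]
  [SMul Rᵐᵒᵖ M] [DistribSMul R B] [DistribSMul Rᵐᵒᵖ B] [SMulCommClass R Rᵐᵒᵖ B] [SMul R N]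

/-- The map `m ⊗ b ↦ m ⊗ (b ⊗ n)`. -/
def assocAux (R M B : Type u) {N : Type u} [AddCommGroup M] [AddCommGroup B] [AddCommGroup N]
    [SMul Rᵐᵒᵖ M] [DistribSMul R B] [DistribSMul Rᵐᵒᵖ B] [SMulCommClass R Rᵐᵒᵖ B] [SMul R N]
    (n : N) : BTensor R M B →+ BTensor R M (BTensor R B N) :=
  lTensor M ((mk R B N).flip n) (fun r b => (left_smul_tmul r b n).symm)

theorem assocAux_tmul (n : N) (m : M) (b : B) :
    assocAux R M B n (tmul R m b) = tmul R m (tmul R b n) :=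
  lTensor_tmul _ (fun r b => (left_smul_tmul r b n).symm) m b

/-- The canonical map `(M ⊗_R B) ⊗_R N → M ⊗_R (B ⊗_R N)`, `(m ⊗ b) ⊗ n ↦ m ⊗ (b ⊗ n)`. -/
def assoc (R M B N : Type u) [AddCommGroup M] [AddCommGroup B] [AddCommGroup N]
    [SMul Rᵐᵒᵖ M] [DistribSMul R B] [DistribSMul Rᵐᵒᵖ B] [SMulCommClass R Rᵐᵒᵖ B] [SMul R N] :
    BTensor R (BTensor R M B) N →+ BTensor R M (BTensor R B N) :=
  lift
    (AddMonoidHom.flip (AddMonoidHom.mk' (fun n : N => assocAux R M B n)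
      (fun n n' => hom_ext (fun m b => by
        rw [AddMonoidHom.add_apply, assocAux_tmul, assocAux_tmul, assocAux_tmul, tmul_add,
          tmul_add]))))
    (fun t r n => by
      change assocAux R M B n (op r • t) = assocAux R M B (r • n) t
      refine induction_on t (by rw [smul_zero, map_zero, map_zero])
        (fun m b => by rw [op_smul_tmul, assocAux_tmul, assocAux_tmul, smul_tmul]) ?_
      intro s t hs ht
      rw [smul_add, map_add, map_add, hs, ht])

@[simp] theorem assoc_tmul (m : M) (b : B) (n : N) :
    assoc R M B N (tmul R (tmul R m b) n) = tmul R m (tmul R b n) :=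
  (lift_tmul _ _ (tmul R m b) n).trans (assocAux_tmul n m b)

end Assoc

end BTensor

/-! Modules over a non-unital ring and firmness. -/

/-- A left module over a ring `R` that need not have a unit.
A right `R`-module is a `NonUnitalModule Rᵐᵒᵖ M`. -/
class NonUnitalModule (R M : Type u) [NonUnitalRing R] [AddCommGroup M] extends
    DistribSMul R M where
  add_smul : ∀ (r s : R) (m : M), (r + s) • m = r • m + s • m
  mul_smul : ∀ (r s : R) (m : M), (r * s) • m = r • s • m

section Firm

variable (R : Type u) [NonUnitalRing R]

instance : NonUnitalModule R R where
  smul_zero := mul_zero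
  smul_add := mul_add
  add_smul := add_mul
  mul_smul := mul_assoc

instance : NonUnitalModule Rᵐᵒᵖ R where
  smul_zero r := zero_mul r.unop
  smul_add r x y := add_mul x y r.unop
  add_smul r s x := mul_add x r.unop s.unop
  mul_smul r s x := (mul_assoc x s.unop r.unop).symm

instance : SMulCommClass R Rᵐᵒᵖ R :=
  ⟨fun r s x => (mul_assoc r x s.unop).symm⟩

/-- The multiplication map `M ⊗_R R → M`, `m ⊗ r ↦ m · r`. -/
def rightMulMap (M : Type u) [AddCommGroup M] [NonUnitalModule Rᵐᵒᵖ M] : BTensor R M R →+ M :=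
  BTensor.lift
    (AddMonoidHom.flip (AddMonoidHom.mk'
      (fun r : R => DistribSMul.toAddMonoidHom M (op r))
      (fun r s => by ext m; exact NonUnitalModule.add_smul (op r) (op s) m)))
    (fun m r s => (NonUnitalModule.mul_smul (op s) (op r) m).symm)

@[simp] theorem rightMulMap_tmul (M : Type u) [AddCommGroup M] [NonUnitalModule Rᵐᵒᵖ M]
    (m : M) (r : R) : rightMulMap R M (BTensor.tmul R m r) = op r • m :=
  BTensor.lift_tmul _ _ m r

/-- The multiplication map `R ⊗_R N → N`, `r ⊗ n ↦ r · n`. -/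
def leftMulMap (N : Type u) [AddCommGroup N] [NonUnitalModule R N] : BTensor R R N →+ N :=
  BTensor.lift
    (AddMonoidHom.mk'
      (fun r : R => DistribSMul.toAddMonoidHom N r)
      (fun r s => by ext n; exact NonUnitalModule.add_smul r s n))
    (fun r s n => NonUnitalModule.mul_smul r s n)

/-- A right `R`-module is firm if the multiplication map `M ⊗_R R → M` is bijective. -/
def IsFirmRight (M : Type u) [AddCommGroup M] [NonUnitalModule Rᵐᵒᵖ M] : Prop :=
  Function.Bijective (rightMulMap R M)

/-- A left `R`-module is firm if the multiplication map `R ⊗_R N → N` is bijective. -/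
def IsFirmLeft (N : Type u) [AddCommGroup N] [NonUnitalModule R N] : Prop :=
  Function.Bijective (leftMulMap R N)

/-- A firm ring: the multiplication map `R ⊗_R R → R` is bijective. -/
def IsFirmRing : Prop := IsFirmRight R R

/-- Flatness of a left `R`-module `F`: the functor `- ⊗_R F` from all (not necessarily firm)
right `R`-modules to abelian groups is left exact. -/
def IsFlatLeft (F : Type u) [AddCommGroup F] [NonUnitalModule R F] : Prop :=
  ∀ (X Y Z : Type u) [AddCommGroup X] [AddCommGroup Y] [AddCommGroup Z]
    [NonUnitalModule Rᵐᵒᵖ X] [NonUnitalModule Rᵐᵒᵖ Y] [NonUnitalModule Rᵐᵒᵖ Z]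
    (f : X →+ Y) (g : Y →+ Z) (hf : ∀ (r : R) x, f (op r • x) = op r • f x)
    (hg : ∀ (r : R) y, g (op r • y) = op r • g y),
    Function.Injective f → Function.Exact f g →
      Function.Injective (BTensor.rTensor F f hf) ∧
        Function.Exact (BTensor.rTensor F f hf) (BTensor.rTensor F g hg)

/-- An object of the category of firm right `R`-modules. -/
structure FirmMod where
  carrier : Type u
  [addCommGroup : AddCommGroup carrier]
  [module : NonUnitalModule Rᵐᵒᵖ carrier]
  firm : IsFirmRight R carrier

attribute [instance] FirmMod.addCommGroup FirmMod.module

/-- Morphisms of firm modules are the additive right `R`-linear maps. -/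
instance : Category (FirmMod R) where
  Hom X Y := {f : X.carrier →+ Y.carrier // ∀ (r : R) x, f (op r • x) = op r • f x}
  id X := ⟨AddMonoidHom.id _, fun _ _ => rfl⟩
  comp f g := ⟨g.1.comp f.1, fun r x => by simp [f.2, g.2]⟩

/-- The right `R`-module `X ⊗_R R`, with `(x ⊗ s) · r = x ⊗ s r`. -/
instance (X : Type u) [AddCommGroup X] [SMul Rᵐᵒᵖ X] : NonUnitalModule Rᵐᵒᵖ (BTensor R X R) where
  add_smul a b t := by
    refine BTensor.induction_on t (by simp only [smul_zero, add_zero]) ?_ ?_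
    · intro x r
      simp only [BTensor.op_smul_tmul, NonUnitalModule.add_smul, BTensor.tmul_add]
    · intro s t hs ht
      rw [smul_add, hs, ht, smul_add, smul_add]; abel
  mul_smul a b t := by
    refine BTensor.induction_on t (by simp only [smul_zero]) ?_ ?_
    · intro x r
      simp only [BTensor.op_smul_tmul, NonUnitalModule.mul_smul]
    · intro s t hs ht
      rw [smul_add, hs, ht, smul_add, smul_add]

variable {R}

theorem rightMulMap_smul (M : Type u) [AddCommGroup M] [NonUnitalModule Rᵐᵒᵖ M] (r : Rᵐᵒᵖ)
    (t : BTensor R M R) : rightMulMap R M (r • t) = r • rightMulMap R M t := by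
  refine BTensor.induction_on t (by simp only [smul_zero, map_zero]) ?_ ?_
  · intro m s
    rw [BTensor.op_smul_tmul, rightMulMap_tmul, rightMulMap_tmul, ← NonUnitalModule.mul_smul]
    rfl
  · intro s t hs ht
    rw [smul_add, map_add, hs, ht, map_add, smul_add]

/-- Over a firm ring `R`, the right module `X ⊗_R R` is firm for every right module `X`. -/
theorem isFirmRight_tensor (hR : IsFirmRing R) (X : Type u) [AddCommGroup X]
    [NonUnitalModule Rᵐᵒᵖ X] : IsFirmRight R (BTensor R X R) := by
  let e : BTensor R R R ≃+ R := AddEquiv.ofBijective (rightMulMap R R) hR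
  have he : ∀ s r : R, e (BTensor.tmul R s r) = s * r := fun s r => rightMulMap_tmul R R s r
  let j : X →+ BTensor R R R →+ BTensor R (BTensor R X R) R :=
    AddMonoidHom.mk'
      (fun x => BTensor.rTensor R (BTensor.mk R X R x) (fun r s => by simp))
      (fun x y => BTensor.hom_ext (fun s r => by
        rw [AddMonoidHom.add_apply]
        erw [BTensor.rTensor_tmul, BTensor.rTensor_tmul, BTensor.rTensor_tmul]
        simp [BTensor.add_tmul]))
  have hj : ∀ x s r, j x (BTensor.tmul R s r) = BTensor.tmul R (BTensor.tmul R x s) r :=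
    fun x s r => BTensor.rTensor_tmul (BTensor.mk R X R x) (fun r s => by simp) s r
  have hjb : ∀ (x : X) (r : R) (t : BTensor R R R), j (op r • x) t = j x (r • t) := by
    intro x r t
    refine BTensor.induction_on t (by simp only [smul_zero, map_zero]) ?_ ?_
    · intro s r'
      rw [hj, BTensor.left_smul_tmul, hj, BTensor.smul_tmul]
    · intro s t hs ht
      rw [smul_add, map_add, hs, ht, map_add]
  have hes : ∀ (r : R) (t : BTensor R R R), e (r • t) = r * e t := by
    intro r t
    refine BTensor.induction_on t (by simp only [smul_zero, map_zero, mul_zero]) ?_ ?_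
    · intro s r'
      rw [BTensor.left_smul_tmul, he, he, smul_eq_mul, mul_assoc]
    · intro s t hs ht
      rw [smul_add, map_add, hs, ht, map_add, mul_add]
  have hesymm : ∀ r s : R, e.symm (r * s) = r • e.symm s := by
    intro r s
    apply e.injective
    rw [hes, e.apply_symm_apply, e.apply_symm_apply]
  let k : BTensor R X R →+ BTensor R (BTensor R X R) R :=
    BTensor.lift ((AddMonoidHom.compHom.flip e.symm.toAddMonoidHom).comp j)
      (fun x r s => by
        change j (op r • x) (e.symm s) = j x (e.symm (r * s))
        rw [hjb, hesymm])
  have hk : ∀ x r, k (BTensor.tmul R x r) = j x (e.symm r) := fun x r => by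
    simp only [k, BTensor.lift_tmul]; rfl
  have h1 : ∀ t, k (rightMulMap R (BTensor R X R) t) = t := by
    intro t
    refine BTensor.induction_on t (by simp only [map_zero]) ?_ ?_
    · intro y r
      refine BTensor.induction_on y ?_ ?_ ?_
      · rw [rightMulMap_tmul, smul_zero, map_zero]
        exact (DFunLike.congr_fun (map_zero (BTensor.mk R (BTensor R X R) R)) r).symm
      · intro x s
        rw [rightMulMap_tmul, BTensor.op_smul_tmul, hk, op_smul_eq_mul, ← he,
          e.symm_apply_apply, hj]
      · intro y z hy hz
        rw [BTensor.add_tmul, map_add, map_add, hy, hz]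
    · intro s t hs ht
      rw [map_add, map_add, hs, ht]
  have h2 : ∀ t, rightMulMap R (BTensor R X R) (k t) = t := by
    have h3 : ∀ x (t : BTensor R R R),
        rightMulMap R (BTensor R X R) (j x t) = BTensor.tmul R x (e t) := by
      intro x t
      refine BTensor.induction_on t ?_ ?_ ?_
      · rw [map_zero, map_zero, map_zero]
        exact (map_zero (BTensor.mk R X R x)).symm
      · intro s r
        rw [hj, rightMulMap_tmul, BTensor.op_smul_tmul, he, op_smul_eq_mul]
      · intro s t hs ht
        rw [map_add, map_add, hs, ht, map_add, BTensor.tmul_add]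
    intro t
    refine BTensor.induction_on t (by simp only [map_zero]) ?_ ?_
    · intro x r
      rw [hk, h3, e.apply_symm_apply]
    · intro s t hs ht
      rw [map_add, map_add, hs, ht]
  exact ⟨fun s t h => by rw [← h1 s, h, h1], fun t => ⟨k t, h2 t⟩⟩

end Firm

/-! Corings, their left duals, and comodules. -/

section Contraction

variable {A : Type u} [Ring A]

/-- `M ⊗_A N → M`, `m ⊗ n ↦ m · f(n)`, for a left `A`-linear map `f : N → A`. -/
def rightContract (M : Type u) {N : Type u} [AddCommGroup M] [AddCommGroup N] [Module Aᵐᵒᵖ M]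
    [Module A N] (f : N →ₗ[A] A) : BTensor A M N →+ M :=
  BTensor.lift
    (AddMonoidHom.flip (AddMonoidHom.mk'
      (fun n => DistribSMul.toAddMonoidHom M (op (f n)))
      (fun n n' => by ext m; simp [add_smul])))
    (fun m a n => by simp [mul_smul])

@[simp] theorem rightContract_tmul {M N : Type u} [AddCommGroup M] [AddCommGroup N]
    [Module Aᵐᵒᵖ M] [Module A N] (f : N →ₗ[A] A) (m : M) (n : N) :
    rightContract M f (BTensor.tmul A m n) = op (f n) • m := by
  simp [rightContract]

/-- `M ⊗_A N → N`, `m ⊗ n ↦ f(m) · n`, for a right `A`-linear map `f : M → A`. -/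
def leftContract {M : Type u} (N : Type u) [AddCommGroup M] [AddCommGroup N] [Module Aᵐᵒᵖ M]
    [Module A N] (f : M →ₗ[Aᵐᵒᵖ] A) : BTensor A M N →+ N :=
  BTensor.lift
    (AddMonoidHom.mk'
      (fun m => DistribSMul.toAddMonoidHom N (f m))
      (fun m m' => by ext n; simp [add_smul]))
    (fun m a n => by simp [mul_smul])

@[simp] theorem leftContract_tmul {M N : Type u} [AddCommGroup M] [AddCommGroup N]
    [Module Aᵐᵒᵖ M] [Module A N] (f : M →ₗ[Aᵐᵒᵖ] A) (m : M) (n : N) :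
    leftContract N f (BTensor.tmul A m n) = f m • n := by
  simp [leftContract]

theorem rightContract_add {M N : Type u} [AddCommGroup M] [AddCommGroup N]
    [Module Aᵐᵒᵖ M] [Module A N] (f g : N →ₗ[A] A) (t : BTensor A M N) :
    rightContract M (f + g) t = rightContract M f t + rightContract M g t := by
  refine BTensor.induction_on t (by simp only [map_zero, add_zero])
    (fun m n => by simp [add_smul]) ?_
  intro s t hs ht
  simp only [map_add, hs, ht]; abel

theorem leftContract_add {M N : Type u} [AddCommGroup M] [AddCommGroup N]
    [Module Aᵐᵒᵖ M] [Module A N] (f g : M →ₗ[Aᵐᵒᵖ] A) (t : BTensor A M N) :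
    leftContract N (f + g) t = leftContract N f t + leftContract N g t := by
  refine BTensor.induction_on t (by simp only [map_zero, add_zero])
    (fun m n => by simp [add_smul]) ?_
  intro s t hs ht
  simp only [map_add, hs, ht]; abel

/-- `f ⊗_A C` for a right `A`-linear map `f`. -/
def rightTensor {M N : Type u} (C : Type u) [AddCommGroup M] [AddCommGroup N] [Module Aᵐᵒᵖ M]
    [Module Aᵐᵒᵖ N] [AddCommGroup C] [Module A C] (f : M →ₗ[Aᵐᵒᵖ] N) :
    BTensor A M C →+ BTensor A N C :=
  BTensor.rTensor C f.toAddMonoidHom (by intro a m; exact map_smul f (op a) m)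

@[simp] theorem rightTensor_tmul {C M N : Type u} [AddCommGroup C] [Module A C]
    [AddCommGroup M] [AddCommGroup N] [Module Aᵐᵒᵖ M]
    [Module Aᵐᵒᵖ N] (f : M →ₗ[Aᵐᵒᵖ] N) (m : M) (c : C) :
    rightTensor C f (BTensor.tmul A m c) = BTensor.tmul A (f m) c :=
  BTensor.rTensor_tmul _ _ m c

theorem rightTensor_add {C M N : Type u} [AddCommGroup C] [Module A C]
    [AddCommGroup M] [AddCommGroup N] [Module Aᵐᵒᵖ M]
    [Module Aᵐᵒᵖ N] (f g : M →ₗ[Aᵐᵒᵖ] N) (t : BTensor A M C) :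
    rightTensor C (f + g) t = rightTensor C f t + rightTensor C g t := by
  refine BTensor.induction_on t (by simp only [map_zero, add_zero])
    (fun m c => by simp [BTensor.add_tmul]) ?_
  intro s t hs ht
  simp only [map_add, hs, ht]; abel

theorem rightTensor_zero {C M N : Type u} [AddCommGroup C] [Module A C]
    [AddCommGroup M] [AddCommGroup N] [Module Aᵐᵒᵖ M]
    [Module Aᵐᵒᵖ N] (t : BTensor A M C) : rightTensor C (0 : M →ₗ[Aᵐᵒᵖ] N) t = 0 := by
  have := rightTensor_add (0 : M →ₗ[Aᵐᵒᵖ] N) 0 t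
  rwa [add_zero, left_eq_add] at this

theorem rightTensor_id {C M : Type u} [AddCommGroup C] [Module A C]
    [AddCommGroup M] [Module Aᵐᵒᵖ M] (t : BTensor A M C) :
    rightTensor C (LinearMap.id : M →ₗ[Aᵐᵒᵖ] M) t = t := by
  refine BTensor.induction_on t (by simp only [map_zero]) (fun m c => by simp) ?_
  intro s t hs ht
  simp only [map_add, hs, ht]

theorem rightTensor_comp {C M N P : Type u} [AddCommGroup C] [Module A C]
    [AddCommGroup M] [AddCommGroup N] [AddCommGroup P]
    [Module Aᵐᵒᵖ M] [Module Aᵐᵒᵖ N] [Module Aᵐᵒᵖ P] (f : M →ₗ[Aᵐᵒᵖ] N) (g : N →ₗ[Aᵐᵒᵖ] P)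
    (t : BTensor A M C) : rightTensor C (g ∘ₗ f) t = rightTensor C g (rightTensor C f t) := by
  refine BTensor.induction_on t (by simp only [map_zero]) (fun m c => by simp) ?_
  intro s t hs ht
  simp only [map_add, hs, ht]

/-- `M ⊗_A g` for a left `A`-linear map `g`. -/
def leftTensor (M : Type u) {B N : Type u} [AddCommGroup M] [Module Aᵐᵒᵖ M] [AddCommGroup B]
    [AddCommGroup N] [Module A B] [Module A N] (g : B →ₗ[A] N) :
    BTensor A M B →+ BTensor A M N :=
  BTensor.lTensor M g.toAddMonoidHom (by intro a b; exact map_smul g a b)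

@[simp] theorem leftTensor_tmul {M B N : Type u} [AddCommGroup M] [Module Aᵐᵒᵖ M]
    [AddCommGroup B] [AddCommGroup N] [Module A B] [Module A N] (g : B →ₗ[A] N) (m : M) (b : B) :
    leftTensor M g (BTensor.tmul A m b) = BTensor.tmul A m (g b) :=
  BTensor.lTensor_tmul _ _ m b

theorem leftContract_rightTensor {C M N : Type u} [AddCommGroup C] [Module A C]
    [AddCommGroup M] [AddCommGroup N] [Module Aᵐᵒᵖ M]
    [Module Aᵐᵒᵖ N] (f : M →ₗ[Aᵐᵒᵖ] N) (g : N →ₗ[Aᵐᵒᵖ] A) (t : BTensor A M C) :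
    leftContract C g (rightTensor C f t) = leftContract C (g ∘ₗ f) t := by
  refine BTensor.induction_on t (by simp only [map_zero]) (fun m c => by simp) ?_
  intro s t hs ht
  simp only [map_add, hs, ht]

end Contraction

/-- A comultiplication and a counit on an `A`-bimodule, both bimodule maps. -/
class CoringStruct (A C : Type u) [Ring A] [AddCommGroup C] [Module A C] [Module Aᵐᵒᵖ C]
    [SMulCommClass A Aᵐᵒᵖ C] where
  comul : C →ₗ[A] BTensor A C C
  comul_op_smul : ∀ (a : A) (c : C), comul (op a • c) = op a • comul c
  counit : C →ₗ[A] A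
  counit_op_smul : ∀ (a : A) (c : C), counit (op a • c) = counit c * a

section Coring

variable (A C : Type u) [Ring A] [AddCommGroup C] [Module A C] [Module Aᵐᵒᵖ C]
  [SMulCommClass A Aᵐᵒᵖ C]

/-- The counit as a right `A`-linear map. -/
def CoringStruct.counitRight [CoringStruct A C] : C →ₗ[Aᵐᵒᵖ] A where
  toFun := counit (C := C)
  map_add' := map_add _
  map_smul' a c := by
    rw [← op_unop a, counit_op_smul]
    rfl

/-- The comultiplication as a right `A`-linear map. -/
def CoringStruct.comulRight [CoringStruct A C] : C →ₗ[Aᵐᵒᵖ] BTensor A C C where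
  toFun := comul (A := A) (C := C)
  map_add' := map_add _
  map_smul' a c := by
    rw [← op_unop a, comul_op_smul]
    rfl

/-- An `A`-coring: a comonoid in the monoidal category of `A`-bimodules. -/
class Coring extends CoringStruct A C where
  coassoc : ∀ c : C,
    BTensor.assoc A C C C
        (rightTensor C (CoringStruct.comulRight A C) (comul c))
      = leftTensor C comul (comul c)
  counit_comul_left : ∀ c : C, leftContract C (CoringStruct.counitRight A C) (comul c) = c
  counit_comul_right : ∀ c : C, rightContract C counit (comul c) = c

/-- A right `C`-comodule structure on a right `A`-module `M`. -/
class Comodule [Coring A C] (M : Type u) [AddCommGroup M] [Module Aᵐᵒᵖ M] where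
  coact : M →ₗ[Aᵐᵒᵖ] BTensor A M C
  coassoc : ∀ m : M,
    BTensor.assoc A M C C (rightTensor C coact (coact m))
      = leftTensor M (CoringStruct.comul (A := A) (C := C)) (coact m)
  counit_coact : ∀ m : M,
    rightContract M (CoringStruct.counit (A := A) (C := C)) (coact m) = m

/-- An object of the category of right `C`-comodules. -/
structure Comod [Coring A C] where
  carrier : Type u
  [addCommGroup : AddCommGroup carrier]
  [module : Module Aᵐᵒᵖ carrier]
  [comodule : Comodule A C carrier]

attribute [instance] Comod.addCommGroup Comod.module Comod.comodule

variable {A C} [Coring A C]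

namespace Comod

/-- The coaction of a comodule. -/
def coact (M : Comod A C) : M.carrier →ₗ[Aᵐᵒᵖ] BTensor A M.carrier C := Comodule.coact

/-- The group of `C`-colinear maps: right `A`-linear `f` with `(f ⊗ C) ∘ ρ = ρ ∘ f`. -/
def homs (M N : Comod A C) : AddSubgroup (M.carrier →ₗ[Aᵐᵒᵖ] N.carrier) where
  carrier := {f | ∀ m, rightTensor C f (M.coact m) = N.coact (f m)}
  zero_mem' m := by simp [rightTensor_zero]
  add_mem' {f g} hf hg m := by
    rw [rightTensor_add, hf m, hg m, LinearMap.add_apply, map_add]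
  neg_mem' {f} hf m := by
    have h := rightTensor_add f (-f) (M.coact m)
    rw [add_neg_cancel, rightTensor_zero, hf m] at h
    rw [LinearMap.neg_apply, map_neg]
    exact (neg_eq_of_add_eq_zero_right h.symm).symm

/-- The category of right `C`-comodules and `C`-colinear maps. -/
instance : Category (Comod A C) where
  Hom M N := homs M N
  id M := ⟨LinearMap.id, fun m => rightTensor_id _⟩
  comp {M N P} f g := ⟨g.1 ∘ₗ f.1, fun m => by
    rw [rightTensor_comp, f.2 m, g.2 (f.1 m)]; rfl⟩

/-- The right `A`-linear map underlying a morphism of comodules. -/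
def Hom.toLin {M N : Comod A C} (f : M ⟶ N) : M.carrier →ₗ[Aᵐᵒᵖ] N.carrier :=
  (show homs M N from f).1

theorem Hom.colinear {M N : Comod A C} (f : M ⟶ N) (m : M.carrier) :
    rightTensor C (Hom.toLin f) (M.coact m) = N.coact (Hom.toLin f m) :=
  (show homs M N from f).2 m

instance : Preadditive (Comod A C) where
  homGroup M N := inferInstanceAs (AddCommGroup (homs M N))
  add_comp _ _ _ f g h := Subtype.ext (LinearMap.comp_add f.1 g.1 h.1)
  comp_add _ _ _ f g h := Subtype.ext (LinearMap.add_comp f.1 h.1 g.1)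

theorem Hom.toLin_add {M N : Comod A C} (f g : M ⟶ N) :
    Hom.toLin (f + g) = Hom.toLin f + Hom.toLin g := rfl

theorem Hom.toLin_comp {M N P : Comod A C} (f : M ⟶ N) (g : N ⟶ P) :
    Hom.toLin (f ≫ g) = Hom.toLin g ∘ₗ Hom.toLin f := rfl

end Comod

/-- The convolution product on the left dual `*C`: `(f * g)(c) = g(c₁ f(c₂))`. -/
def starMul (f g : C →ₗ[A] A) : C →ₗ[A] A where
  toFun c := g (rightContract C f (CoringStruct.comul (A := A) c))
  map_add' c d := by rw [map_add, map_add, map_add]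
  map_smul' a c := by
    have h : ∀ t : BTensor A C C, rightContract C f (a • t) = a • rightContract C f t := by
      intro t
      refine BTensor.induction_on t (by simp only [smul_zero, map_zero])
        (fun x y => by simp [smul_comm]) ?_
      intro s t hs ht
      simp only [smul_add, map_add, hs, ht]
    rw [map_smul, h, map_smul]
    rfl

variable (A C)

/-- A right `A`-submodule `N` of `*C`, where `(f · a)(c) = f(c) a`, is rational if it has a
`C`-comodule structure with `f * g = f₀ · g(f₁)` for all `f ∈ N` and `g ∈ *C`. -/
def IsRational (N : Submodule Aᵐᵒᵖ (C →ₗ[A] A)) : Prop :=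
  ∃ κ : Comodule A C N, ∀ (f : N) (g : C →ₗ[A] A),
    starMul (f : C →ₗ[A] A) g = (rightContract N g (κ.coact f) : N)

/-- `Rat(*C)`, the largest rational submodule of the right `*C`-module `*C`. -/
def ratDual : Submodule Aᵐᵒᵖ (C →ₗ[A] A) := sSup {N | IsRational A C N}

/-- The finite topology on `*C`: the topology of pointwise convergence, `A` being discrete. -/
@[reducible] def finiteTopology : TopologicalSpace (C →ₗ[A] A) :=
  TopologicalSpace.induced (fun f : C →ₗ[A] A => (f : C → A)) (@Pi.topologicalSpace C _ fun _ => ⊥)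

end Coring

/-- A left `A`-module `P` is weakly locally projective if, for every `f : P → N`, every
surjective `g : M → N` and every finitely generated submodule `E` of `P`, there is
`h : P → M` such that `g ∘ h` and `f` agree on `E`. -/
def IsWeaklyLocallyProjective (A P : Type u) [Ring A] [AddCommGroup P] [Module A P] : Prop :=
  ∀ (E : Submodule A P), E.FG →
    ∀ (M N : Type u) [AddCommGroup M] [AddCommGroup N] [Module A M] [Module A N]
      (g : M →ₗ[A] N) (f : P →ₗ[A] N), Function.Surjective g →
      ∃ h : P →ₗ[A] M, ∀ x ∈ E, g (h x) = f x

/-! A comodule `S` with a ring `R` acting by colinear maps. -/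

section Galois

variable {A C R : Type u} [Ring A] [AddCommGroup C] [Module A C] [Module Aᵐᵒᵖ C]
  [SMulCommClass A Aᵐᵒᵖ C] [Coring A C] [NonUnitalRing R] {S : Comod A C}

open Comod

/-- `S` as a left `R`-module through `ι`: `r · x = ι(r)(x)`. -/
def LeftMod (_ι : R →ₙ+* End S) : Type u := S.carrier

instance (ι : R →ₙ+* End S) : AddCommGroup (LeftMod ι) :=
  inferInstanceAs (AddCommGroup S.carrier)

instance (ι : R →ₙ+* End S) : NonUnitalModule R (LeftMod ι) where
  smul r x := Hom.toLin (ι r) x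
  smul_zero r := map_zero (Hom.toLin (ι r))
  smul_add r := map_add (Hom.toLin (ι r))
  add_smul r s x := by
    change Hom.toLin (ι (r + s)) x = Hom.toLin (ι r) x + Hom.toLin (ι s) x
    rw [map_add]
    exact DFunLike.congr_fun (Hom.toLin_add (ι r : S ⟶ S) (ι s : S ⟶ S)) x
  mul_smul r s x := by
    change Hom.toLin (ι (r * s)) x = Hom.toLin (ι r) (Hom.toLin (ι s) x)
    rw [map_mul]; rfl

/-- `Hom^C(S, M)` as a right `R`-module through `ι`: `φ · r = φ ∘ ι(r)`. -/
def HomMod (_ι : R →ₙ+* End S) (M : Comod A C) : Type u := S ⟶ M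

instance (ι : R →ₙ+* End S) (M : Comod A C) : AddCommGroup (HomMod ι M) :=
  inferInstanceAs (AddCommGroup (S ⟶ M))

instance (ι : R →ₙ+* End S) (M : Comod A C) : NonUnitalModule Rᵐᵒᵖ (HomMod ι M) where
  smul r φ := ((ι r.unop : S ⟶ S) ≫ (φ : S ⟶ M) : S ⟶ M)
  smul_zero r := Limits.comp_zero (f := (ι r.unop : S ⟶ S)) (Z := M)
  smul_add r φ ψ := Preadditive.comp_add S S M (ι r.unop) φ ψ
  add_smul r s φ := by
    change ((ι (r.unop + s.unop) : S ⟶ S) ≫ (φ : S ⟶ M) : S ⟶ M) = _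
    rw [map_add]
    exact Preadditive.add_comp S S M (ι r.unop) (ι s.unop) φ
  mul_smul r s φ := by
    change ((ι (s.unop * r.unop) : S ⟶ S) ≫ (φ : S ⟶ M) : S ⟶ M) = _
    rw [map_mul]
    exact Category.assoc (ι r.unop : S ⟶ S) (ι s.unop : S ⟶ S) (φ : S ⟶ M)

/-- Composition with `g : M ⟶ N` on `Hom^C(S, -)`. -/
def HomMod.map (ι : R →ₙ+* End S) {M N : Comod A C} (g : M ⟶ N) : HomMod ι M →+ HomMod ι N :=
  AddMonoidHom.mk' (fun φ => ((φ : S ⟶ M) ≫ g : S ⟶ N))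
    (fun φ ψ => Preadditive.add_comp S M N φ ψ g)

theorem HomMod.map_smul (ι : R →ₙ+* End S) {M N : Comod A C} (g : M ⟶ N) (r : R)
    (φ : HomMod ι M) : HomMod.map ι g (op r • φ) = op r • HomMod.map ι g φ :=
  Category.assoc (ι r : S ⟶ S) (φ : S ⟶ M) g

/-- The functor `Hom^C(S, -) ⊗_R R` from right `C`-comodules to firm right `R`-modules. -/
def coinvFunctor (hR : IsFirmRing R) (ι : R →ₙ+* End S) : Comod A C ⥤ FirmMod R where
  obj M := { carrier := BTensor R (HomMod ι M) R, firm := isFirmRight_tensor hR (HomMod ι M) }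
  map {M N} g := ⟨BTensor.rTensor R (HomMod.map ι g) (HomMod.map_smul ι g), fun r t => by
    refine BTensor.induction_on t (by simp only [smul_zero, map_zero]) (fun φ s => by simp) ?_
    intro s t hs ht
    simp only [smul_add, map_add, hs, ht]⟩
  map_id M := Subtype.ext (BTensor.hom_ext (fun φ r => by
    rw [BTensor.rTensor_tmul]; rfl))
  map_comp f g := Subtype.ext (BTensor.hom_ext (fun φ r => by
    rw [BTensor.rTensor_tmul]
    symm
    refine (congrArg (BTensor.rTensor R (HomMod.map ι g) (HomMod.map_smul ι g))
      (BTensor.rTensor_tmul (HomMod.map ι f) (HomMod.map_smul ι f) φ r)).trans ?_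
    refine (BTensor.rTensor_tmul (HomMod.map ι g) (HomMod.map_smul ι g) _ r).trans ?_
    exact congrArg (fun ψ : HomMod ι _ => BTensor.tmul R ψ r) (Category.assoc (φ : S ⟶ _) f g)))

/-- `Hom_A(S, M)`, for a right `A`-module `M`, as a right `R`-module: `φ · r = φ ∘ ι(r)`. -/
def LinMod (_ι : R →ₙ+* End S) (M : Type u) [AddCommGroup M] [Module Aᵐᵒᵖ M] : Type u :=
  S.carrier →ₗ[Aᵐᵒᵖ] M

instance (ι : R →ₙ+* End S) (M : Type u) [AddCommGroup M] [Module Aᵐᵒᵖ M] :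
    AddCommGroup (LinMod ι M) :=
  inferInstanceAs (AddCommGroup (S.carrier →ₗ[Aᵐᵒᵖ] M))

instance (ι : R →ₙ+* End S) (M : Type u) [AddCommGroup M] [Module Aᵐᵒᵖ M] :
    NonUnitalModule Rᵐᵒᵖ (LinMod ι M) where
  smul r φ := LinearMap.comp (φ : S.carrier →ₗ[Aᵐᵒᵖ] M) (Hom.toLin (ι r.unop))
  smul_zero r := LinearMap.zero_comp (Hom.toLin (ι r.unop))
  smul_add r φ ψ := LinearMap.add_comp (Hom.toLin (ι r.unop)) ψ φ
  add_smul r s φ := by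
    change LinearMap.comp (φ : S.carrier →ₗ[Aᵐᵒᵖ] M) (Hom.toLin (ι (r.unop + s.unop))) = _
    rw [map_add]
    exact LinearMap.comp_add (Hom.toLin (ι r.unop)) (Hom.toLin (ι s.unop)) φ
  mul_smul r s φ := by
    change LinearMap.comp (φ : S.carrier →ₗ[Aᵐᵒᵖ] M) (Hom.toLin (ι (s.unop * r.unop))) = _
    rw [map_mul]
    rfl

/-- An element of `LinMod ι M` as a right `A`-linear map. -/
def LinMod.toLin {ι : R →ₙ+* End S} {M : Type u} [AddCommGroup M] [Module Aᵐᵒᵖ M]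
    (φ : LinMod ι M) : S.carrier →ₗ[Aᵐᵒᵖ] M := φ

/-- The canonical map `can_M : Hom_A(S, M) ⊗_R S → M ⊗_A C`, `φ ⊗ x ↦ φ(x₀) ⊗ x₁`. -/
def canMap (ι : R →ₙ+* End S) (M : Type u) [AddCommGroup M] [Module Aᵐᵒᵖ M] :
    BTensor R (LinMod ι M) (LeftMod ι) →+ BTensor A M C :=
  BTensor.lift
    (AddMonoidHom.mk'
      (fun φ : LinMod ι M =>
        (AddMonoidHom.comp (rightTensor C (LinMod.toLin φ))
          (S.coact).toAddMonoidHom : S.carrier →+ BTensor A M C))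
      (fun φ ψ => AddMonoidHom.ext (fun x => rightTensor_add _ _ (S.coact x))))
    (fun φ r x => by
      change rightTensor C (LinearMap.comp (LinMod.toLin φ) (Hom.toLin (ι r)))
          (S.coact x) = rightTensor C (LinMod.toLin φ) (S.coact (Hom.toLin (ι r) x))
      rw [rightTensor_comp]
      exact congrArg _ (Hom.colinear (ι r : S ⟶ S) x))

@[simp] theorem canMap_tmul (ι : R →ₙ+* End S) (M : Type u) [AddCommGroup M] [Module Aᵐᵒᵖ M]
    (φ : LinMod ι M) (x : LeftMod ι) :
    canMap ι M (BTensor.tmul R φ x) = rightTensor C (LinMod.toLin φ) (S.coact x) :=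
  BTensor.lift_tmul _ _ φ x

/-- `S` is an `R`-comonadic Galois comodule: `can_M` is an isomorphism for all right
`A`-modules `M`. -/
def IsComonadicGalois (ι : R →ₙ+* End S) : Prop :=
  ∀ (M : Type u) [AddCommGroup M] [Module Aᵐᵒᵖ M], Function.Bijective (canMap ι M)

/-- Evaluation at `c` as a right `A`-linear map `*C → A`. -/
def evalDual (A : Type u) {C : Type u} [Ring A] [AddCommGroup C] [Module A C] (c : C) :
    (C →ₗ[A] A) →ₗ[Aᵐᵒᵖ] A where
  toFun f := f c
  map_add' _ _ := rfl
  map_smul' _ _ := rfl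

/-- `q(x₀)(c) x₁ - c₁ q(x)(c₂)` as an additive function of `q : S → *C`. -/
def moritaDefect (ι : R →ₙ+* End S) (x : S.carrier) (c : C) : LinMod ι (C →ₗ[A] A) →+ C :=
  AddMonoidHom.mk'
    (fun q => leftContract C
        (evalDual A c ∘ₗ (LinMod.toLin q)) (S.coact x)
      - rightContract C ((LinMod.toLin q) x)
          (CoringStruct.comul (A := A) c))
    (fun p q => by
      have h1 := leftContract_add
        (evalDual A c ∘ₗ (LinMod.toLin p))
        (evalDual A c ∘ₗ (LinMod.toLin q)) (S.coact x)
      have h2 := rightContract_add ((LinMod.toLin p) x)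
        ((LinMod.toLin q) x) (CoringStruct.comul (A := A) c)
      rw [← LinearMap.comp_add] at h1
      exact (congrArg₂ (fun a b : C => a - b) h1 h2).trans (add_sub_add_comm _ _ _ _))

/-- The module `Q` of the Morita context of `S`: all right `A`-linear `q : S → *C` with
`q(x₀)(c) x₁ = c₁ q(x)(c₂)` for all `x ∈ S` and `c ∈ C`. -/
def moritaQ (ι : R →ₙ+* End S) : AddSubgroup (LinMod ι (C →ₗ[A] A)) :=
  ⨅ (x : S.carrier) (c : C), (moritaDefect ι x c).ker

theorem mem_moritaQ (ι : R →ₙ+* End S) (q : LinMod ι (C →ₗ[A] A)) :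
    q ∈ moritaQ ι ↔ ∀ (x : S.carrier) (c : C),
      leftContract C
          (evalDual A c ∘ₗ (LinMod.toLin q)) (S.coact x)
        = rightContract C ((LinMod.toLin q) x)
            (CoringStruct.comul (A := A) c) := by
  simp only [moritaQ, AddSubgroup.mem_iInf, AddMonoidHom.mem_ker]
  exact forall₂_congr fun x c => sub_eq_zero

/-- `Q` is stable under the right action of `R`, `q · r = q ∘ ι(r)`. -/
theorem smul_mem_moritaQ (ι : R →ₙ+* End S) (r : Rᵐᵒᵖ) {q : LinMod ι (C →ₗ[A] A)}
    (hq : q ∈ moritaQ ι) : r • q ∈ moritaQ ι := by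
  rw [mem_moritaQ] at hq ⊢
  intro x c
  have h := hq (Hom.toLin (ι r.unop : S ⟶ S) x) c
  rw [← Hom.colinear (ι r.unop : S ⟶ S) x, leftContract_rightTensor] at h
  exact h

instance (ι : R →ₙ+* End S) : NonUnitalModule Rᵐᵒᵖ (moritaQ ι) where
  smul r q := ⟨r • q.1, smul_mem_moritaQ ι r q.2⟩
  smul_zero r := Subtype.ext (smul_zero (A := LinMod ι (C →ₗ[A] A)) r)
  smul_add r p q := Subtype.ext (smul_add r p.1 q.1)
  add_smul r s q := Subtype.ext (NonUnitalModule.add_smul r s q.1)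
  mul_smul r s q := Subtype.ext (NonUnitalModule.mul_smul r s q.1)

/-- The Morita map `Q ⊗_R S → *C`, `q ⊗ x ↦ q(x)`. -/
def moritaMap (ι : R →ₙ+* End S) : BTensor R (moritaQ ι) (LeftMod ι) →+ (C →ₗ[A] A) :=
  BTensor.lift
    (AddMonoidHom.mk'
      (fun q => LinearMap.toAddMonoidHom (LinMod.toLin q.1))
      (fun _ _ => rfl))
    (fun _ _ _ => rfl)

@[simp] theorem moritaMap_tmul (ι : R →ₙ+* End S) (q : moritaQ ι) (x : LeftMod ι) :
    moritaMap ι (BTensor.tmul R q x) = LinMod.toLin q.1 x :=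
  BTensor.lift_tmul _ _ q x

end Galois

/-! Everything passes through one condition: for every comodule `M` the evaluation `evMap : Hom^C(S,
M) ⊗_R S → M` is surjective. This is equivalent to `S` being a generator: the image of evaluation
has a quotient comodule, and the projection onto it kills every morphism from `S`.

Weak local projectivity supplies local dual bases, so elements of `M ⊗_A C` are separated by
contraction with functionals on `C`. Comodules thereby become certain modules over the left dual,
and colinearity, coassociativity and subcomodules can all be tested on the action `m · g = m₀
g(m₁)`.

The engine is `tensor_eq_zero_of_evMap_eq_zero`. Write an element of `X ⊗_R S` as `∑ xᵢ ⊗ rᵢ sᵢ`.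
The tuples in `S^n` satisfying the same relations in `M` as `s` form a subcomodule, hence are sums
of values of tuples `ψ` of endomorphisms. As `R` is a right ideal, each `rᵢ ψᵢ` is some `ρᵢ` in `R`,
and `∑ xᵢ ⊗ rᵢ ψᵢ(y) = (∑ xᵢ ρᵢ) ⊗ y`. The left factor is annihilated by `R`, so the tensor with the
firm module `S` vanishes. This one argument gives injectivity of the canonical map, injectivity of
the counit behind full faithfulness, and flatness tested on submodules of free modules; free covers
extend flatness to all modules.

Conversely, flatness and the Galois property recover `M` as the equalizer of `M ⊗_A C ⇉ M ⊗_A C ⊗_A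
C`, and faithfulness alone makes `S` a generator. Finally, `Q` consists of the `*C`-linear maps `S →
*C`. A generator reaches all of `Rat(*C)`; if `Q` reaches `Rat(*C)`, density yields `e = ∑ qᵢ(xᵢ)`
with `m · e = m`, and each `x ↦ m · qᵢ(x)` is colinear. -/

namespace BTensor

/-! ### Additivity and right exactness of balanced tensor products. -/

section Additive

variable {R M N P : Type u} [AddCommGroup M] [AddCommGroup N] [AddCommGroup P]
  [SMul Rᵐᵒᵖ M] [SMul R N]

theorem tmul_zero (m : M) : tmul R m (0 : N) = 0 := map_zero (mk R M N m)

theorem zero_tmul (n : N) : tmul R (0 : M) n = 0 := DFunLike.congr_fun (map_zero (mk R M N)) n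

theorem tmul_sum {κ : Type*} (s : Finset κ) (m : M) (n : κ → N) :
    tmul R m (∑ i ∈ s, n i) = ∑ i ∈ s, tmul R m (n i) := map_sum (mk R M N m) n s

theorem sum_tmul {κ : Type*} (s : Finset κ) (m : κ → M) (n : N) :
    tmul R (∑ i ∈ s, m i) n = ∑ i ∈ s, tmul R (m i) n := map_sum ((mk R M N).flip n) m s

theorem hom_congr {f g : BTensor R M N →+ P} (h : ∀ m n, f (tmul R m n) = g (tmul R m n))
    (t : BTensor R M N) : f t = g t := DFunLike.congr_fun (hom_ext h) t

end Additive

section RightExact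

variable {R X Y Z N : Type u} [AddCommGroup X] [AddCommGroup Y] [AddCommGroup Z]
  [AddCommGroup N] [SMul Rᵐᵒᵖ X] [SMul Rᵐᵒᵖ Y] [SMul Rᵐᵒᵖ Z] [SMul R N]

theorem rTensor_surjective {g : Y →+ Z} {hg : ∀ (r : R) y, g (op r • y) = op r • g y}
    (hgs : Function.Surjective g) : Function.Surjective (rTensor N g hg) := by
  intro t
  refine induction_on t ⟨0, map_zero _⟩ (fun z n => ?_) ?_
  · obtain ⟨y, rfl⟩ := hgs z
    exact ⟨tmul R y n, rTensor_tmul _ _ _ _⟩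
  · rintro _ _ ⟨a, rfl⟩ ⟨b, rfl⟩
    exact ⟨a + b, map_add _ _ _⟩

/-- Right exactness of `- ⊗_R N`. -/
theorem exists_rTensor_eq {f : X →+ Y} {hf : ∀ (r : R) x, f (op r • x) = op r • f x}
    {g : Y →+ Z} {hg : ∀ (r : R) y, g (op r • y) = op r • g y}
    (hgs : Function.Surjective g) (hex : ∀ y, g y = 0 → ∃ x, f x = y)
    {t : BTensor R Y N} (ht : rTensor N g hg t = 0) : ∃ s, rTensor N f hf s = t := by
  -- A map `L` from `Z ⊗ N` to the cokernel of `f ⊗ N` is built from a set-theoretic section of `g`.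
  -- Two lifts of `z` differ by the image of `f`, so modulo the range the choice is invisible; then
  -- `L ∘ (g ⊗ N) = q` puts the kernel inside the range.
  let q := QuotientAddGroup.mk' (rTensor N f hf).range
  have key : ∀ y y' n, g y = g y' → q (tmul R y n) = q (tmul R y' n) := by
    intro y y' n h
    obtain ⟨x, hx⟩ := hex (y - y') (by rw [map_sub, h, sub_self])
    rw [← sub_eq_zero, ← map_sub]
    refine (QuotientAddGroup.eq_zero_iff _).2 ⟨tmul R x n, ?_⟩
    rw [rTensor_tmul, hx]
    exact DFunLike.congr_fun (map_sub (mk R Y N) y y') n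
  let b : Z →+ N →+ BTensor R Y N ⧸ (rTensor N f hf).range :=
    AddMonoidHom.mk' (fun z => q.comp (mk R Y N (Function.surjInv hgs z))) (by
      intro z z'
      ext n
      change q (tmul R _ n) = q (tmul R _ n) + q (tmul R _ n)
      rw [← map_add, ← add_tmul]
      refine key _ _ n ?_
      simp only [map_add, Function.surjInv_eq])
  let L : BTensor R Z N →+ BTensor R Y N ⧸ (rTensor N f hf).range :=
    lift b (by
      intro z r n
      change q (tmul R _ n) = q (tmul R _ (r • n))
      rw [← smul_tmul]
      refine key _ _ n ?_
      rw [hg]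
      simp only [Function.surjInv_eq])
  have hL : ∀ t, L (rTensor N g hg t) = q t := by
    refine hom_congr (f := L.comp (rTensor N g hg)) (g := q) ?_
    intro y n
    rw [AddMonoidHom.comp_apply, rTensor_tmul]
    refine (lift_tmul _ _ _ _).trans (key _ _ n ?_)
    simp only [Function.surjInv_eq]
  have := hL t
  rw [ht, map_zero] at this
  exact (QuotientAddGroup.eq_zero_iff _).1 this.symm

end RightExact

/-- Lets an identity in `M ⊗ (C ⊗ C)` be tested in `(M ⊗ C) ⊗ C`, where contractions separate
elements. Injectivity is never needed. -/
theorem assoc_surjective {R M B N : Type u} [AddCommGroup M] [AddCommGroup B] [AddCommGroup N]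
    [SMul Rᵐᵒᵖ M] [DistribSMul R B] [DistribSMul Rᵐᵒᵖ B] [SMulCommClass R Rᵐᵒᵖ B] [SMul R N] :
    Function.Surjective (assoc R M B N) := by
  intro t
  refine induction_on t ⟨0, map_zero _⟩ (fun m w => ?_) ?_
  · refine induction_on w ⟨0, ?_⟩ (fun b n => ⟨_, assoc_tmul m b n⟩) ?_
    · rw [map_zero, tmul_zero]
    · rintro _ _ ⟨a, ha⟩ ⟨b, hb⟩
      exact ⟨a + b, by rw [map_add, ha, hb, tmul_add]⟩
  · rintro _ _ ⟨a, rfl⟩ ⟨b, rfl⟩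
    exact ⟨a + b, map_add _ _ _⟩

end BTensor

open BTensor

/-! ### Calculus of contractions against functionals. -/

section Contract

variable {A M N : Type u} [Ring A] [AddCommGroup M] [AddCommGroup N] [Module Aᵐᵒᵖ M]
  [Module Aᵐᵒᵖ N]

theorem rightContract_rightTensor {P : Type u} [AddCommGroup P] [Module A P] (g : P →ₗ[A] A)
    (f : M →ₗ[Aᵐᵒᵖ] N) (t : BTensor A M P) :
    rightContract N g (rightTensor P f t) = f (rightContract M g t) := by
  refine hom_congr (f := (rightContract N g).comp (rightTensor P f))
    (g := f.toAddMonoidHom.comp (rightContract M g)) (fun m p => ?_) t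
  simp

theorem rightContract_leftTensor {P P' : Type u} [AddCommGroup P] [Module A P] [AddCommGroup P']
    [Module A P'] (g : P' →ₗ[A] A) (f : P →ₗ[A] P') (t : BTensor A M P) :
    rightContract M g (leftTensor M f t) = rightContract M (g ∘ₗ f) t := by
  refine hom_congr (f := (rightContract M g).comp (leftTensor M f))
    (g := rightContract M (g ∘ₗ f)) (fun m p => ?_) t
  simp

theorem leftTensor_rightTensor {P P' : Type u} [AddCommGroup P] [Module A P] [AddCommGroup P']
    [Module A P'] (g : P →ₗ[A] P') (f : M →ₗ[Aᵐᵒᵖ] N) (t : BTensor A M P) :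
    leftTensor N g (rightTensor P f t) = rightTensor P' f (leftTensor M g t) := by
  refine hom_congr (f := (leftTensor N g).comp (rightTensor P f))
    (g := (rightTensor P' f).comp (leftTensor M g)) (fun m p => ?_) t
  simp

theorem leftTensor_comp {P P' P'' : Type u} [AddCommGroup P] [Module A P] [AddCommGroup P']
    [Module A P'] [AddCommGroup P''] [Module A P''] (g : P →ₗ[A] P') (h : P' →ₗ[A] P'')
    (t : BTensor A M P) : leftTensor M h (leftTensor M g t) = leftTensor M (h ∘ₗ g) t := by
  refine hom_congr (f := (leftTensor M h).comp (leftTensor M g))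
    (g := leftTensor M (h ∘ₗ g)) (fun m p => ?_) t
  simp

theorem apply_leftContract {C : Type u} [AddCommGroup C] [Module A C] (g : C →ₗ[A] A)
    (φ : M →ₗ[Aᵐᵒᵖ] A) (t : BTensor A M C) :
    g (leftContract C φ t) = φ (rightContract M g t) := by
  refine hom_congr (f := g.toAddMonoidHom.comp (leftContract C φ))
    (g := φ.toAddMonoidHom.comp (rightContract M g)) (fun m c => ?_) t
  simp

theorem op_smul_rightContract {C : Type u} [AddCommGroup C] [Module A C] (a : Aᵐᵒᵖ)
    (g : C →ₗ[A] A) (t : BTensor A M C) :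
    rightContract M (a • g) t = a • rightContract M g t := by
  refine hom_congr (f := rightContract M (a • g))
    (g := (DistribSMul.toAddMonoidHom M a).comp (rightContract M g)) (fun m c => ?_) t
  rw [rightContract_tmul, AddMonoidHom.comp_apply, rightContract_tmul,
    DistribSMul.toAddMonoidHom_apply, ← mul_smul]
  rfl

theorem leftTensor_id {C : Type u} [AddCommGroup C] [Module A C] (t : BTensor A M C) :
    leftTensor M (LinearMap.id : C →ₗ[A] C) t = t := by
  refine hom_congr (f := leftTensor M LinearMap.id) (g := AddMonoidHom.id _) (fun m c => ?_) t
  simp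

variable {B : Type u} [AddCommGroup B] [Module A B] [Module Aᵐᵒᵖ B] [SMulCommClass A Aᵐᵒᵖ B]

/-- `f ⊗_A B` as a right `A`-linear map for a bimodule `B`. -/
def rightTensorLin (B : Type u) [AddCommGroup B] [Module A B] [Module Aᵐᵒᵖ B]
    [SMulCommClass A Aᵐᵒᵖ B] (f : M →ₗ[Aᵐᵒᵖ] N) : BTensor A M B →ₗ[Aᵐᵒᵖ] BTensor A N B where
  toFun := rightTensor B f
  map_add' := map_add _
  map_smul' a t := by
    refine induction_on t (by simp only [smul_zero, map_zero]) (fun m b => by simp) ?_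
    intro s t hs ht
    simp only [smul_add, map_add, hs, ht]

@[simp] theorem rightTensorLin_apply (f : M →ₗ[Aᵐᵒᵖ] N) (t : BTensor A M B) :
    rightTensorLin B f t = rightTensor B f t := rfl

/-- `B ⊗_A P → B`, `b ⊗ p ↦ b · f(p)`, as a left `A`-linear map for a bimodule `B`. -/
def rightContractLin (B : Type u) [AddCommGroup B] [Module A B] [Module Aᵐᵒᵖ B]
    [SMulCommClass A Aᵐᵒᵖ B] {P : Type u} [AddCommGroup P] [Module A P] (f : P →ₗ[A] A) :
    BTensor A B P →ₗ[A] B where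
  toFun := rightContract B f
  map_add' := map_add _
  map_smul' a t := by
    refine induction_on t (by simp only [smul_zero, map_zero])
      (fun m b => by simp [smul_comm]) ?_
    intro s t hs ht
    simp only [smul_add, map_add, hs, ht]

@[simp] theorem rightContractLin_apply {P : Type u} [AddCommGroup P] [Module A P]
    (f : P →ₗ[A] A) (t : BTensor A B P) : rightContractLin B f t = rightContract B f t := rfl

/-- Only the last factor is contracted, so reassociation does not matter. This turns coassociativity
into associativity of the dual action. -/
theorem rightContract_tensor {P : Type u} [AddCommGroup P] [Module A P] (g : P →ₗ[A] A)
    (t : BTensor A (BTensor A M B) P) :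
    rightContract (BTensor A M B) g t = leftTensor M (rightContractLin B g) (assoc A M B P t) := by
  refine hom_congr (f := rightContract (BTensor A M B) g)
    (g := (leftTensor M (rightContractLin B g)).comp (assoc A M B P)) (fun y p => ?_) t
  refine hom_congr (f := (rightContract (BTensor A M B) g).comp ((mk A (BTensor A M B) P).flip p))
    (g := ((leftTensor M (rightContractLin B g)).comp (assoc A M B P)).comp
      ((mk A (BTensor A M B) P).flip p)) (fun m b => ?_) y
  simp

/-- The right multiplication by `a` as a left `A`-linear endomorphism of a bimodule. -/
def mulRightLin (B : Type u) [AddCommGroup B] [Module A B] [Module Aᵐᵒᵖ B]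
    [SMulCommClass A Aᵐᵒᵖ B] (a : A) : B →ₗ[A] B where
  toFun b := op a • b
  map_add' := smul_add _
  map_smul' a' b := (smul_comm a' (op a) b).symm

@[simp] theorem mulRightLin_apply (a : A) (b : B) : mulRightLin B a b = op a • b := rfl

theorem rightContract_op_smul (g : B →ₗ[A] A) (a : A) (t : BTensor A M B) :
    rightContract M g (op a • t) = rightContract M (g ∘ₗ mulRightLin B a) t := by
  refine induction_on t (by simp only [smul_zero, map_zero]) (fun m b => by simp) ?_
  intro s t hs ht
  simp only [smul_add, map_add, hs, ht]


/-- The map `b ↦ m ⊗ b`. -/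
def tmulLin (B : Type u) [AddCommGroup B] [Module A B] [Module Aᵐᵒᵖ B]
    [SMulCommClass A Aᵐᵒᵖ B] (m : M) :
    B →ₗ[Aᵐᵒᵖ] BTensor A M B where
  toFun c := tmul A m c
  map_add' := tmul_add m
  map_smul' a c := (op_smul_tmul a m c).symm

@[simp] theorem tmulLin_apply (m : M) (c : B) :
    tmulLin (A := A) B m c = tmul A m c := rfl

end Contract

/-! ### Local dual bases and their consequences. -/

section LocallyProjective

variable {A C : Type u} [Ring A] [AddCommGroup C] [Module A C]

/-- The identity of `C` is lifted, on the span of `s`, through the free module on the set `C`. The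
functionals are the coordinates of the lift, and `P` collects the supports of the lifts of all
elements of `s`. -/
theorem IsWeaklyLocallyProjective.exists_dual_basis (hC : IsWeaklyLocallyProjective A C)
    (s : Finset C) :
    ∃ (P : Finset C) (f : C → C →ₗ[A] A), ∀ c ∈ s, ∑ p ∈ P, f p c • p = c := by
  classical
  obtain ⟨h, hh⟩ := hC (Submodule.span A s) ⟨s, rfl⟩ (C →₀ A) C
    (Finsupp.linearCombination A id) LinearMap.id (Finsupp.linearCombination_id_surjective A C)
  refine ⟨s.biUnion fun c => (h c).support, fun p => Finsupp.lapply p ∘ₗ h, fun c hc => ?_⟩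
  have h1 := hh c (Submodule.subset_span hc)
  rw [Finsupp.linearCombination_apply] at h1
  refine Eq.trans ?_ h1
  refine (Finsupp.sum_of_support_subset (h c) ?_ (fun p a => a • id p)
    fun p _ => zero_smul A (id p)).symm
  exact Finset.subset_biUnion_of_mem (fun c => (h c).support) hc

variable {M : Type u} [AddCommGroup M] [Module Aᵐᵒᵖ M]

/-- A tensor involves finitely many elements of `C`, so contraction is continuous for the finite
topology; this is how density will enter. -/
theorem exists_finset_contract_eq (t : BTensor A M C) :
    ∃ s : Finset C, ∀ f g : C →ₗ[A] A, (∀ c ∈ s, f c = g c) →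
      rightContract M f t = rightContract M g t := by
  classical
  refine induction_on t ⟨∅, fun f g _ => by rw [map_zero, map_zero]⟩
    (fun m c => ⟨{c}, fun f g h => ?_⟩) ?_
  · rw [rightContract_tmul, rightContract_tmul, h c (Finset.mem_singleton_self c)]
  · rintro x y ⟨s, hs⟩ ⟨s', hs'⟩
    refine ⟨s ∪ s', fun f g h => ?_⟩
    rw [map_add, map_add, hs f g fun c hc => h c (Finset.mem_union_left _ hc),
      hs' f g fun c hc => h c (Finset.mem_union_right _ hc)]

theorem IsWeaklyLocallyProjective.exists_eq_sum (hC : IsWeaklyLocallyProjective A C)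
    (t : BTensor A M C) :
    ∃ (P : Finset C) (f : C → C →ₗ[A] A),
      t = ∑ p ∈ P, tmul A (rightContract M (f p) t) p := by
  classical
  -- The finite set is fixed before the dual basis, so the induction on `t` only has to unite finite
  -- sets and one basis serves all summands.
  have key : ∃ s : Finset C, ∀ (P : Finset C) (f : C → C →ₗ[A] A),
      (∀ c ∈ s, ∑ p ∈ P, f p c • p = c) →
      t = ∑ p ∈ P, tmul A (rightContract M (f p) t) p := by
    refine induction_on t ⟨∅, fun P f _ => ?_⟩ (fun m c => ⟨{c}, fun P f h => ?_⟩) ?_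
    · simp only [map_zero, zero_tmul, Finset.sum_const_zero]
    · conv_lhs => rw [← h c (Finset.mem_singleton_self c)]
      simp only [tmul_sum, rightContract_tmul, smul_tmul]
    · rintro x y ⟨s, hs⟩ ⟨s', hs'⟩
      refine ⟨s ∪ s', fun P f h => ?_⟩
      have h1 := hs P f fun c hc => h c (Finset.mem_union_left _ hc)
      have h2 := hs' P f fun c hc => h c (Finset.mem_union_right _ hc)
      simp only [map_add, add_tmul, Finset.sum_add_distrib]
      rw [← h1, ← h2]
  obtain ⟨s, hs⟩ := key
  obtain ⟨P, f, hf⟩ := hC.exists_dual_basis s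
  exact ⟨P, f, hs P f hf⟩

/-- For a weakly locally projective `C`, elements of `M ⊗_A C` are separated by the
contractions with the elements of the dual of `C`. -/
theorem IsWeaklyLocallyProjective.ext (hC : IsWeaklyLocallyProjective A C)
    {t t' : BTensor A M C} (h : ∀ f, rightContract M f t = rightContract M f t') : t = t' := by
  rw [← sub_eq_zero]
  obtain ⟨P, f, hf⟩ := hC.exists_eq_sum (t - t')
  rw [hf]
  refine Finset.sum_eq_zero fun p _ => ?_
  rw [map_sub, h, sub_self, zero_tmul]

theorem IsWeaklyLocallyProjective.ext_dual (hC : IsWeaklyLocallyProjective A C)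
    {c d : C} (h : ∀ f : C →ₗ[A] A, f c = f d) : c = d := by
  classical
  obtain ⟨P, f, hf⟩ := hC.exists_dual_basis {c, d}
  rw [← hf c (by simp), ← hf d (by simp)]
  simp only [h]

/-- Contraction commutes with the inclusion of `K` and separates elements; this takes the place of
flatness of `C`. -/
theorem IsWeaklyLocallyProjective.rightTensor_subtype_injective
    (hC : IsWeaklyLocallyProjective A C) (K : Submodule Aᵐᵒᵖ M) :
    Function.Injective (rightTensor C K.subtype) := by
  intro t t' h
  refine hC.ext fun f => K.subtype_injective ?_
  rw [← rightContract_rightTensor, h, rightContract_rightTensor]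

/-- In a local dual basis the coefficients of `t` are contractions of `t`, hence lie in `K`. -/
theorem IsWeaklyLocallyProjective.exists_rightTensor_subtype_eq
    (hC : IsWeaklyLocallyProjective A C) (K : Submodule Aᵐᵒᵖ M) (t : BTensor A M C)
    (h : ∀ f, rightContract M f t ∈ K) : ∃ s, rightTensor C K.subtype s = t := by
  obtain ⟨P, f, hf⟩ := hC.exists_eq_sum t
  refine ⟨∑ p ∈ P, tmul A ⟨_, h (f p)⟩ p, ?_⟩
  rw [map_sum]
  conv_rhs => rw [hf]
  simp

end LocallyProjective

/-! ### Comodules as modules over the left dual. -/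

section Coaction

variable {A C : Type u} [Ring A] [AddCommGroup C] [Module A C] [Module Aᵐᵒᵖ C]
  [SMulCommClass A Aᵐᵒᵖ C] [Coring A C]

/-- `c ↦ c₁ g(c₂)` as a left `A`-linear endomorphism of `C`. -/
def dualAct (g : C →ₗ[A] A) : C →ₗ[A] C :=
  rightContractLin C g ∘ₗ CoringStruct.comul (A := A) (C := C)

theorem comp_dualAct (g h : C →ₗ[A] A) : h ∘ₗ dualAct g = starMul g h := rfl

namespace Comodule

variable {M N : Type u} [AddCommGroup M] [Module Aᵐᵒᵖ M] [AddCommGroup N] [Module Aᵐᵒᵖ N]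

theorem coact_rightContract [Comodule A C M] (g : C →ₗ[A] A) (m : M) :
    coact (A := A) (C := C) (rightContract M g (coact m)) = leftTensor M (dualAct g) (coact m) := by
  rw [← rightContract_rightTensor, rightContract_tensor, Comodule.coassoc, leftTensor_comp]
  rfl

theorem rightContract_rightContract [Comodule A C M] (g h : C →ₗ[A] A) (m : M) :
    rightContract M h (coact (rightContract M g (coact m))) =
      rightContract M (starMul g h) (coact m) := by
  rw [coact_rightContract, rightContract_leftTensor, comp_dualAct]

/-- Over a weakly locally projective coring, a coaction is a map `ρ : M → M ⊗_A C` for which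
`m · g = m₀ g(m₁)` is an action of the left dual ring. -/
abbrev ofAction (hC : IsWeaklyLocallyProjective A C) (ρ : M →ₗ[Aᵐᵒᵖ] BTensor A M C)
    (hmul : ∀ g h m, rightContract M h (ρ (rightContract M g (ρ m))) =
      rightContract M (starMul g h) (ρ m))
    (hone : ∀ m, rightContract M CoringStruct.counit (ρ m) = m) : Comodule A C M where
  coact := ρ
  counit_coact := hone
  coassoc m := by
    -- With both sides moved to `(M ⊗ C) ⊗ C`, two successive contractions reduce coassociativity to
    -- `hmul`.
    obtain ⟨w, hw⟩ := assoc_surjective (R := A) (leftTensor M CoringStruct.comul (ρ m))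
    rw [← hw]
    congr 1
    refine hC.ext fun g => hC.ext fun h => ?_
    rw [rightContract_rightTensor, hmul, rightContract_tensor, hw, leftTensor_comp,
      rightContract_leftTensor]
    rfl

/-- The contraction condition pushes `τ` into `K ⊗ C`, and injectivity of `K ⊗ C → M ⊗ C` transfers
the laws. Linearity of `τ` is asked for pointwise because for the rational elements `τ` comes from
arbitrary choices. -/
theorem exists_of_submodule (hC : IsWeaklyLocallyProjective A C) (K : Submodule Aᵐᵒᵖ M)
    (τ : K → BTensor A M C) (hK : ∀ k g, rightContract M g (τ k) ∈ K)
    (hadd : ∀ k k', τ (k + k') = τ k + τ k') (hsmul : ∀ (a : Aᵐᵒᵖ) k, τ (a • k) = a • τ k)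
    (hmul : ∀ g h k, rightContract M h (τ ⟨rightContract M g (τ k), hK k g⟩) =
      rightContract M (starMul g h) (τ k))
    (hone : ∀ k, rightContract M CoringStruct.counit (τ k) = k) :
    ∃ κ : Comodule A C K, ∀ k, rightTensor C K.subtype (κ.coact k) = τ k := by
  choose ρ hρ using fun k => hC.exists_rightTensor_subtype_eq K (τ k) (hK k)
  have inj := hC.rightTensor_subtype_injective K
  have hc : ∀ g k, (rightContract K g (ρ k) : M) = rightContract M g (τ k) := fun g k => by
    rw [← hρ, rightContract_rightTensor]
    rfl
  refine ⟨ofAction hC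
    { toFun := ρ
      map_add' := fun k k' => inj (by rw [map_add, hρ, hρ, hρ, hadd])
      map_smul' := fun a k => inj (by
        rw [hρ, hsmul, RingHom.id_apply]
        refine Eq.trans ?_ (map_smul (rightTensorLin C K.subtype) a (ρ k)).symm
        rw [rightTensorLin_apply, hρ]) }
    (fun g h k => Subtype.ext ?_) (fun k => Subtype.ext ?_), hρ⟩
  · change (rightContract K h (ρ (rightContract K g (ρ k))) : M) = (rightContract K _ (ρ k) : M)
    rw [hc, hc, ← hmul]
    congr 3
    exact Subtype.ext (hc g k)
  · change (rightContract K _ (ρ k) : M) = k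
    rw [hc, hone]

instance regular : Comodule A C C where
  coact := CoringStruct.comulRight A C
  coassoc := Coring.coassoc
  counit_coact := Coring.counit_comul_right

end Comodule

theorem dualAct_comp_dualAct (g h : C →ₗ[A] A) : dualAct h ∘ₗ dualAct g = dualAct (starMul g h) :=
  LinearMap.ext fun c => Comodule.rightContract_rightContract (M := C) g h c

theorem dualAct_counit : dualAct (CoringStruct.counit (A := A) (C := C)) = LinearMap.id :=
  LinearMap.ext fun c => Coring.counit_comul_right c

theorem starMul_assoc (f g h : C →ₗ[A] A) : starMul (starMul f g) h = starMul f (starMul g h) := by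
  rw [← comp_dualAct (starMul f g), ← dualAct_comp_dualAct]
  rfl

theorem starMul_add_left (f f' g : C →ₗ[A] A) :
    starMul (f + f') g = starMul f g + starMul f' g :=
  LinearMap.ext fun c =>
    (congrArg g (rightContract_add f f' (CoringStruct.comul c))).trans (map_add g _ _)

/-- By linearity `ε(c₁ f(c₂)) = ε(c₁) f(c₂) = f(ε(c₁) c₂)`, and the left counit law applies. -/
theorem starMul_counit_right (f : C →ₗ[A] A) : starMul f CoringStruct.counit = f := by
  ext c
  have h : ∀ t : BTensor A C C, CoringStruct.counit (rightContract C f t) =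
      f (leftContract C (CoringStruct.counitRight A C) t) := by
    intro t
    refine hom_congr (f := (CoringStruct.counit (A := A) (C := C)).toAddMonoidHom.comp
      (rightContract C f)) (g := f.toAddMonoidHom.comp (leftContract C _)) (fun x y => ?_) t
    simp only [AddMonoidHom.comp_apply, LinearMap.toAddMonoidHom_coe, rightContract_tmul,
      leftContract_tmul, CoringStruct.counit_op_smul, map_smul, smul_eq_mul]
    rfl
  exact (h _).trans (congrArg f (Coring.counit_comul_left c))

theorem starMul_smul_left (f g : C →ₗ[A] A) (a : A) :
    starMul (op a • f) g = starMul f (g ∘ₗ mulRightLin C a) := by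
  ext c
  have h : ∀ t : BTensor A C C, rightContract C (op a • f) t = op a • rightContract C f t := by
    intro t
    refine hom_congr (f := rightContract C (op a • f)) (g := (DistribSMul.toAddMonoidHom C
      (op a)).comp (rightContract C f)) (fun x y => ?_) t
    simp [mul_smul]
  exact congrArg g (h _)

end Coaction

/-! ### The cofree comodules `M ⊗_A C`. -/

section Cofree

variable {A C : Type u} [Ring A] [AddCommGroup C] [Module A C] [Module Aᵐᵒᵖ C]
  [SMulCommClass A Aᵐᵒᵖ C] [Coring A C]

variable (M : Type u) [AddCommGroup M] [Module Aᵐᵒᵖ M]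

/-- The additive map underlying the coaction `m ⊗ c ↦ (m ⊗ c₁) ⊗ c₂` of `M ⊗_A C`. -/
def cofreeCoactAux (A C M : Type u) [Ring A] [AddCommGroup C] [Module A C] [Module Aᵐᵒᵖ C]
    [SMulCommClass A Aᵐᵒᵖ C] [Coring A C] [AddCommGroup M] [Module Aᵐᵒᵖ M] :
    BTensor A M C →+ BTensor A (BTensor A M C) C :=
  BTensor.lift
    (AddMonoidHom.mk' (fun m => (rightTensor C (tmulLin C m)).comp
        (CoringStruct.comul (A := A) (C := C)).toAddMonoidHom) (by
      intro m m'
      ext c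
      have h : tmulLin (A := A) C (m + m') = tmulLin C m + tmulLin C m' :=
        LinearMap.ext fun c => add_tmul m m' c
      simp [h, rightTensor_add]))
    (by
      intro m a c
      have h : ∀ t : BTensor A C C, rightTensor C (tmulLin C (op a • m)) t =
          rightTensor C (tmulLin C m) (a • t) := by
        intro t
        refine induction_on t (by simp only [smul_zero, map_zero])
          (fun x y => by simp [smul_tmul]) ?_
        intro s t hs ht
        simp only [smul_add, map_add, hs, ht]
      simp [h])

theorem cofreeCoactAux_tmul (m : M) (c : C) : cofreeCoactAux A C M (tmul A m c) =
    rightTensor C (tmulLin C m) (CoringStruct.comul (A := A) c) := lift_tmul _ _ m c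

theorem rightContract_cofreeCoactAux (g : C →ₗ[A] A) (t : BTensor A M C) :
    rightContract _ g (cofreeCoactAux A C M t) = leftTensor M (dualAct g) t := by
  refine hom_congr (f := (rightContract _ g).comp (cofreeCoactAux A C M))
    (g := leftTensor M (dualAct g)) (fun m c => ?_) t
  rw [AddMonoidHom.comp_apply, cofreeCoactAux_tmul, rightContract_rightTensor, leftTensor_tmul]
  rfl

/-- The coaction `m ⊗ c ↦ (m ⊗ c₁) ⊗ c₂` of `M ⊗_A C`. -/
def cofreeCoact (A C M : Type u) [Ring A] [AddCommGroup C] [Module A C] [Module Aᵐᵒᵖ C]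
    [SMulCommClass A Aᵐᵒᵖ C] [Coring A C] [AddCommGroup M] [Module Aᵐᵒᵖ M] :
    BTensor A M C →ₗ[Aᵐᵒᵖ] BTensor A (BTensor A M C) C where
  toFun := cofreeCoactAux A C M
  map_add' := map_add _
  map_smul' a t := by
    refine induction_on t (by simp only [smul_zero, map_zero]) (fun m c => ?_) ?_
    · rw [op_smul_tmul, cofreeCoactAux_tmul, cofreeCoactAux_tmul]
      have h1 := CoringStruct.comul_op_smul (A := A) (C := C) a.unop c
      rw [op_unop] at h1
      rw [h1]
      exact map_smul (rightTensorLin C (tmulLin C m)) a _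
    · intro s t hs ht
      simp only [smul_add, map_add, hs, ht]

theorem rightContract_cofreeCoact (g : C →ₗ[A] A) (t : BTensor A M C) :
    rightContract _ g (cofreeCoact A C M t) = leftTensor M (dualAct g) t :=
  rightContract_cofreeCoactAux M g t

/-- The cofree comodule `M ⊗_A C`. -/
def Comod.cofree (hC : IsWeaklyLocallyProjective A C) : Comod A C where
  carrier := BTensor A M C
  comodule := Comodule.ofAction hC (cofreeCoact A C M)
    (fun g h t => by
      rw [rightContract_cofreeCoact, rightContract_cofreeCoact, rightContract_cofreeCoact,
        leftTensor_comp, dualAct_comp_dualAct])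
    (fun t => by rw [rightContract_cofreeCoact, dualAct_counit, leftTensor_id])

/-- `m ⊗ c ↦ m ε(c)` as a right `A`-linear map. -/
def counitContract (C M : Type u) [AddCommGroup C] [Module A C] [Module Aᵐᵒᵖ C]
    [SMulCommClass A Aᵐᵒᵖ C] [Coring A C] [AddCommGroup M] [Module Aᵐᵒᵖ M] :
    BTensor A M C →ₗ[Aᵐᵒᵖ] M where
  toFun := rightContract M (CoringStruct.counit (A := A) (C := C))
  map_add' := map_add _
  map_smul' a t := by
    refine induction_on t (by simp only [smul_zero, map_zero]) (fun m c => ?_) ?_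
    · have h1 := CoringStruct.counit_op_smul (A := A) (C := C) a.unop c
      rw [op_unop] at h1
      simp [h1, mul_smul]
    · intro s t hs ht
      simp only [smul_add, map_add, hs, ht]

/-- A triangle identity of the adjunction between forgetting the coaction and `- ⊗_A C`: a colinear
map into `M ⊗_A C` is recovered from its composite with `M ⊗ ε`. -/
theorem rightTensor_counitContract_cofreeCoact (t : BTensor A M C) :
    rightTensor C (counitContract C M) (cofreeCoact A C M t) = t := by
  refine hom_congr (f := (rightTensor C (counitContract C M)).comp (cofreeCoactAux A C M))
    (g := AddMonoidHom.id _) (fun m c => ?_) t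
  rw [AddMonoidHom.comp_apply, cofreeCoactAux_tmul, ← rightTensor_comp]
  have h : ∀ t : BTensor A C C, rightTensor C (counitContract C M ∘ₗ tmulLin C m) t =
      tmul A m (leftContract C (CoringStruct.counitRight A C) t) := by
    intro t
    refine hom_congr (f := rightTensor C (counitContract C M ∘ₗ tmulLin C m))
      (g := (BTensor.mk A M C m).comp (leftContract C (CoringStruct.counitRight A C)))
      (fun x y => ?_) t
    rw [rightTensor_tmul, AddMonoidHom.comp_apply, leftContract_tmul, mk_apply, ← smul_tmul]
    exact congrArg (fun z => tmul A z y) (rightContract_tmul _ m x)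
  rw [h, Coring.counit_comul_left]
  rfl

end Cofree

/-! ### The action of the left dual on a comodule, and morphisms into cofree comodules. -/

namespace Comod

variable {A C : Type u} [Ring A] [AddCommGroup C] [Module A C] [Module Aᵐᵒᵖ C]
  [SMulCommClass A Aᵐᵒᵖ C] [Coring A C]

/-- A morphism of comodules from a colinear map. -/
def homMk {M N : Comod A C} (f : M.carrier →ₗ[Aᵐᵒᵖ] N.carrier)
    (hf : ∀ m, rightTensor C f (M.coact m) = N.coact (f m)) : M ⟶ N := ⟨f, hf⟩

@[simp] theorem toLin_homMk {M N : Comod A C} (f : M.carrier →ₗ[Aᵐᵒᵖ] N.carrier)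
    (hf : ∀ m, rightTensor C f (M.coact m) = N.coact (f m)) : Hom.toLin (homMk f hf) = f := rfl

theorem hom_ext {M N : Comod A C} {f g : M ⟶ N} (h : ∀ m, Hom.toLin f m = Hom.toLin g m) :
    f = g := Subtype.ext (LinearMap.ext h)

/-- The action `m · g = m₀ g(m₁)`. -/
def act (M : Comod A C) (m : M.carrier) (g : C →ₗ[A] A) : M.carrier :=
  rightContract M.carrier g (M.coact m)

theorem toLin_act {M N : Comod A C} (f : M ⟶ N) (m : M.carrier) (g : C →ₗ[A] A) :
    Hom.toLin f (M.act m g) = N.act (Hom.toLin f m) g := by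
  rw [act, act, ← Hom.colinear, rightContract_rightTensor]

theorem colinear_of_act (hC : IsWeaklyLocallyProjective A C) {M N : Comod A C}
    (f : M.carrier →ₗ[Aᵐᵒᵖ] N.carrier) (hf : ∀ m g, f (M.act m g) = N.act (f m) g)
    (m : M.carrier) : rightTensor C f (M.coact m) = N.coact (f m) :=
  hC.ext fun g => by
    rw [rightContract_rightTensor]
    exact hf m g

theorem act_counit (M : Comod A C) (m : M.carrier) : M.act m CoringStruct.counit = m :=
  Comodule.counit_coact m

theorem act_act (M : Comod A C) (m : M.carrier) (g h : C →ₗ[A] A) :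
    M.act (M.act m g) h = M.act m (starMul g h) :=
  Comodule.rightContract_rightContract g h m

/-- The morphism `x ↦ φ(x₀) ⊗ x₁` to the cofree comodule. -/
def toCofree (hC : IsWeaklyLocallyProjective A C) {S : Comod A C} {M : Type u} [AddCommGroup M]
    [Module Aᵐᵒᵖ M] (φ : S.carrier →ₗ[Aᵐᵒᵖ] M) : S ⟶ cofree M hC :=
  homMk (N := cofree M hC) (rightTensorLin C φ ∘ₗ S.coact) (colinear_of_act hC _ fun m g => by
    have h1 := rightContract_cofreeCoact M g (rightTensor C φ (S.coact m))
    rw [leftTensor_rightTensor] at h1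
    refine Eq.trans ?_ h1.symm
    exact congrArg (rightTensor C φ) (Comodule.coact_rightContract g m))

end Comod

/-! ### The rational part of the dual and its density. -/

section Rational

variable {A C : Type u} [Ring A] [AddCommGroup C] [Module A C] [Module Aᵐᵒᵖ C]
  [SMulCommClass A Aᵐᵒᵖ C] [Coring A C]

/-- The elements `f` of `*C` for which there is `f₀ ⊗ f₁ ∈ *C ⊗_A C` with
`f * g = f₀ g(f₁)` for all `g`. -/
def rationalElements (A C : Type u) [Ring A] [AddCommGroup C] [Module A C] [Module Aᵐᵒᵖ C]
    [SMulCommClass A Aᵐᵒᵖ C] [Coring A C] : Submodule Aᵐᵒᵖ (C →ₗ[A] A) where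
  carrier := {f | ∃ t : BTensor A (C →ₗ[A] A) C, ∀ g, starMul f g = rightContract _ g t}
  zero_mem' := ⟨0, fun g => by
    rw [map_zero]
    have h := starMul_add_left (0 : C →ₗ[A] A) 0 g
    rwa [add_zero, left_eq_add] at h⟩
  add_mem' := by
    rintro f f' ⟨t, ht⟩ ⟨t', ht'⟩
    exact ⟨t + t', fun g => by rw [starMul_add_left, ht, ht', map_add]⟩
  smul_mem' := by
    rintro a f ⟨t, ht⟩
    refine ⟨a • t, fun g => ?_⟩
    rw [← op_unop a, starMul_smul_left, ht, rightContract_op_smul]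

/-- The tensor representing `f` is unique because contractions separate, so arbitrary choices `τ`
are automatically linear. Associativity of convolution shows that `f * g` is again rational and that
the resulting coaction is coassociative. -/
theorem isRational_rationalElements (hC : IsWeaklyLocallyProjective A C) :
    IsRational A C (rationalElements A C) := by
  choose τ hτ using fun f : rationalElements A C => f.2
  have hK : ∀ (f : rationalElements A C) g, rightContract _ g (τ f) ∈ rationalElements A C :=
    fun f g => ⟨leftTensor _ (dualAct g) (τ f), fun h => by
      rw [rightContract_leftTensor, comp_dualAct, ← hτ, ← hτ, starMul_assoc]⟩
  obtain ⟨κ, hκ⟩ := Comodule.exists_of_submodule hC (rationalElements A C) τ hK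
    (fun f f' => hC.ext fun g => by
      rw [map_add, ← hτ, ← hτ, ← hτ, Submodule.coe_add, starMul_add_left])
    (fun a f => hC.ext fun g => by
      rw [← op_unop a, rightContract_op_smul, ← hτ, ← hτ, Submodule.coe_smul,
        starMul_smul_left])
    (fun g h f => by
      rw [← hτ, ← hτ f (starMul g h)]
      change starMul (rightContract _ g (τ f)) h = _
      rw [← hτ, starMul_assoc])
    (fun f => by rw [← hτ, starMul_counit_right])
  refine ⟨κ, fun f g => ?_⟩
  rw [hτ, ← hκ, rightContract_rightTensor]
  rfl

/-- A rational submodule consists of rational elements, and these form a rational submodule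
themselves. Membership in the supremum can thus be tested one functional at a time. -/
theorem ratDual_eq (hC : IsWeaklyLocallyProjective A C) :
    ratDual A C = rationalElements A C := by
  refine le_antisymm (sSup_le ?_) (le_sSup (isRational_rationalElements hC))
  rintro N ⟨κ, hκ⟩ f hf
  refine ⟨rightTensor C N.subtype (κ.coact ⟨f, hf⟩), fun g => ?_⟩
  rw [rightContract_rightTensor]
  exact hκ ⟨f, hf⟩ g

theorem isRational_ratDual (hC : IsWeaklyLocallyProjective A C) :
    IsRational A C (ratDual A C) :=
  ratDual_eq hC ▸ isRational_rationalElements hC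

theorem exists_mem_ratDual_eqOn
    (hdense : @Dense (C →ₗ[A] A) (finiteTopology A C) (ratDual A C)) (g : C →ₗ[A] A)
    (s : Finset C) : ∃ e ∈ ratDual A C, ∀ c ∈ s, e c = g c := by
  let _ : TopologicalSpace A := ⊥
  let _ : TopologicalSpace (C →ₗ[A] A) := finiteTopology A C
  have : DiscreteTopology A := ⟨rfl⟩
  have hcont : Continuous (fun f : C →ₗ[A] A => (f : C → A)) := continuous_induced_dom
  have hopen : IsOpen {f : C →ₗ[A] A | ∀ c ∈ s, f c = g c} := by
    have h : {f : C →ₗ[A] A | ∀ c ∈ s, f c = g c} =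
        ⋂ c ∈ s, (fun f : C →ₗ[A] A => f c) ⁻¹' {g c} := by
      ext f
      simp
    rw [h]
    exact isOpen_biInter_finset fun c _ =>
      (isOpen_discrete _).preimage ((continuous_apply c).comp hcont)
  obtain ⟨e, he, he'⟩ := hdense.inter_open_nonempty _ hopen ⟨g, fun _ _ => rfl⟩
  exact ⟨e, he', he⟩

end Rational

/-! ### Firm modules and the evaluation map. -/

section Evaluation

variable {A C R : Type u} [Ring A] [AddCommGroup C] [Module A C] [Module Aᵐᵒᵖ C]
  [SMulCommClass A Aᵐᵒᵖ C] [Coring A C] [NonUnitalRing R] {S : Comod A C}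

open Comod

/-- Uses only `N = RN`, that is, surjectivity of the multiplication map. -/
theorem IsFirmLeft.induction {N : Type u} [AddCommGroup N] [NonUnitalModule R N]
    (hN : IsFirmLeft R N) {p : N → Prop} (x : N) (h0 : p 0) (h1 : ∀ (r : R) x, p (r • x))
    (h2 : ∀ x y, p x → p y → p (x + y)) : p x := by
  obtain ⟨t, rfl⟩ := hN.2 x
  refine induction_on t (by rwa [map_zero]) (fun r x => ?_) fun s t hs ht => ?_
  · have : leftMulMap R N (tmul R r x) = r • x := lift_tmul _ _ r x
    rw [this]
    exact h1 r x
  · rw [map_add]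
    exact h2 _ _ hs ht

/-- Since `x ⊗ r y = x r ⊗ y` and `N = RN`, a firm module does not see elements annihilated by `R`.
-/
theorem IsFirmLeft.tmul_eq_zero {N X : Type u} [AddCommGroup N] [NonUnitalModule R N]
    (hN : IsFirmLeft R N) [AddCommGroup X] [NonUnitalModule Rᵐᵒᵖ X] {x : X}
    (hx : ∀ r : R, op r • x = 0) (y : N) : tmul R x y = 0 := by
  refine hN.induction (p := fun y => tmul R x y = 0) y (tmul_zero x) (fun r y => ?_)
    fun y y' h h' => ?_
  · rw [← BTensor.smul_tmul, hx, zero_tmul]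
  · rw [tmul_add, h, h', add_zero]

/-- In this normal form each `r i` stands ready to absorb an endomorphism of `S` through the right
ideal property. -/
theorem IsFirmLeft.exists_eq_sum {N X : Type u} [AddCommGroup N] [NonUnitalModule R N]
    (hN : IsFirmLeft R N) [AddCommGroup X] [NonUnitalModule Rᵐᵒᵖ X] (z : BTensor R X N) :
    ∃ (n : ℕ) (x : Fin n → X) (r : Fin n → R) (s : Fin n → N),
      z = ∑ i, tmul R (x i) (r i • s i) := by
  have hadd : ∀ z z' : BTensor R X N,
      (∃ (n : ℕ) (x : Fin n → X) (r : Fin n → R) (s : Fin n → N),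
        z = ∑ i, tmul R (x i) (r i • s i)) →
      (∃ (n : ℕ) (x : Fin n → X) (r : Fin n → R) (s : Fin n → N),
        z' = ∑ i, tmul R (x i) (r i • s i)) →
      ∃ (n : ℕ) (x : Fin n → X) (r : Fin n → R) (s : Fin n → N),
        z + z' = ∑ i, tmul R (x i) (r i • s i) := by
    rintro _ _ ⟨n, x, r, s, rfl⟩ ⟨n', x', r', s', rfl⟩
    refine ⟨n + n', Fin.append x x', Fin.append r r', Fin.append s s', ?_⟩
    simp [Fin.sum_univ_add]
  have hzero : ∃ (n : ℕ) (x : Fin n → X) (r : Fin n → R) (s : Fin n → N),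
      (0 : BTensor R X N) = ∑ i, tmul R (x i) (r i • s i) :=
    ⟨0, Fin.elim0, Fin.elim0, Fin.elim0, by simp⟩
  refine induction_on z hzero (fun x₀ y => ?_) hadd
  refine hN.induction (p := fun y => ∃ (n : ℕ) (x : Fin n → X) (r : Fin n → R) (s : Fin n → N),
    tmul R x₀ y = ∑ i, tmul R (x i) (r i • s i)) y ?_
    (fun r y => ⟨1, fun _ => x₀, fun _ => r, fun _ => y, by simp⟩) ?_
  · rw [tmul_zero]
    exact hzero
  · intro y y' h h'
    rw [tmul_add]
    exact hadd _ _ h h'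

/-- An element of `S` as an element of `LeftMod ι`. -/
def LeftMod.of (ι : R →ₙ+* End S) (x : S.carrier) : LeftMod ι := x

/-- A morphism out of `S` as an element of `HomMod ι M`. -/
def HomMod.of (ι : R →ₙ+* End S) {M : Comod A C} (φ : S ⟶ M) : HomMod ι M := φ

/-- An element of `HomMod ι M` as a morphism. -/
def HomMod.hom {ι : R →ₙ+* End S} {M : Comod A C} (φ : HomMod ι M) : S ⟶ M := φ

/-- A morphism out of `S`, as an additive map on `LeftMod ι`. -/
def HomMod.toAddHom {ι : R →ₙ+* End S} {M : Comod A C} (φ : HomMod ι M) :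
    LeftMod ι →+ M.carrier := LinearMap.toAddMonoidHom (Hom.toLin φ.hom)

theorem HomMod.toAddHom_of (ι : R →ₙ+* End S) {M : Comod A C} (φ : HomMod ι M) (x : S.carrier) :
    φ.toAddHom (LeftMod.of ι x) = Hom.toLin φ.hom x := rfl

theorem HomMod.ext {ι : R →ₙ+* End S} {M : Comod A C} {φ ψ : HomMod ι M}
    (h : ∀ x, φ.toAddHom x = ψ.toAddHom x) : φ = ψ := Comod.hom_ext h

theorem HomMod.toAddHom_smul {ι : R →ₙ+* End S} {M : Comod A C} (r : R) (φ : HomMod ι M)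
    (x : LeftMod ι) : (op r • φ).toAddHom x = φ.toAddHom (r • x) := rfl

/-- The evaluation map `Hom^C(S, M) ⊗_R S → M`, `φ ⊗ x ↦ φ(x)`. -/
def evMap (ι : R →ₙ+* End S) (M : Comod A C) :
    BTensor R (HomMod ι M) (LeftMod ι) →+ M.carrier :=
  BTensor.lift (AddMonoidHom.mk' HomMod.toAddHom fun _ _ => rfl) (fun _ _ _ => rfl)

@[simp] theorem evMap_tmul (ι : R →ₙ+* End S) (M : Comod A C) (φ : HomMod ι M) (x : LeftMod ι) :
    evMap ι M (tmul R φ x) = φ.toAddHom x := lift_tmul _ _ φ x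

theorem isSeparator_of_evMap_surjective (ι : R →ₙ+* End S)
    (h : ∀ M : Comod A C, Function.Surjective (evMap ι M)) : IsSeparator S := by
  rw [isSeparator_def]
  intro M N f g hfg
  refine Comod.hom_ext fun m => ?_
  obtain ⟨w, rfl⟩ := h M m
  refine hom_congr (f := (Hom.toLin f).toAddMonoidHom.comp (evMap ι M))
    (g := (Hom.toLin g).toAddMonoidHom.comp (evMap ι M)) (fun φ x => ?_) w
  rw [AddMonoidHom.comp_apply, AddMonoidHom.comp_apply, evMap_tmul]
  exact congrArg (fun ψ => Hom.toLin ψ x) (hfg φ)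

end Evaluation

/-! ### Generators, and vanishing of tensors over `R`. -/

section Generator

variable {A C R : Type u} [Ring A] [AddCommGroup C] [Module A C] [Module Aᵐᵒᵖ C]
  [SMulCommClass A Aᵐᵒᵖ C] [Coring A C] [NonUnitalRing R] {S : Comod A C}

open Comod

/-- The quotient of a comodule by a submodule `T` such that `T` has zero image in
`(M / T) ⊗_A C`. -/
def Comod.quotient (hC : IsWeaklyLocallyProjective A C) (M : Comod A C)
    (T : Submodule Aᵐᵒᵖ M.carrier)
    (hT : T ≤ LinearMap.ker (rightTensorLin C T.mkQ ∘ₗ M.coact)) : Comod A C where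
  carrier := M.carrier ⧸ T
  comodule :=
    have key : ∀ g m, rightContract _ g (T.liftQ (rightTensorLin C T.mkQ ∘ₗ M.coact) hT
        (T.mkQ m)) = T.mkQ (M.act m g) := fun g m => by
      rw [Submodule.mkQ_apply, Submodule.liftQ_apply]
      exact rightContract_rightTensor g T.mkQ (M.coact m)
    Comodule.ofAction hC (T.liftQ (rightTensorLin C T.mkQ ∘ₗ M.coact) hT)
      (fun g h m => by
        obtain ⟨m, rfl⟩ := T.mkQ_surjective m
        rw [key, key, key, act_act])
      (fun m => by
        obtain ⟨m, rfl⟩ := T.mkQ_surjective m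
        rw [key, act_counit])

/-- Let `T` be the image of evaluation. It is a sum of images of colinear maps `φ`, and `T.mkQ ∘ φ =
0`, so colinearity shows that the coaction descends to `M / T`. The projection `M → M / T` vanishes
on all morphisms from `S`, hence is zero. -/
theorem evMap_surjective_of_isSeparator (hC : IsWeaklyLocallyProjective A C)
    (ι : R →ₙ+* End S) (hS : IsSeparator S) (M : Comod A C) :
    Function.Surjective (evMap ι M) := by
  let T : Submodule Aᵐᵒᵖ M.carrier :=
    { (evMap ι M).range with
      smul_mem' := by
        rintro a _ ⟨w, rfl⟩
        refine induction_on w ⟨0, by rw [map_zero, smul_zero]⟩ (fun φ x => ?_) ?_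
        · refine ⟨tmul R φ (LeftMod.of ι (a • (show S.carrier from x))), ?_⟩
          rw [evMap_tmul, evMap_tmul]
          exact map_smul (Hom.toLin φ.hom) a (show S.carrier from x)
        · rintro s t ⟨w, hw⟩ ⟨w', hw'⟩
          exact ⟨w + w', by rw [map_add, hw, hw', map_add, smul_add]⟩ }
  have hmem : ∀ (φ : S ⟶ M) x, Hom.toLin φ x ∈ T := fun φ x =>
    ⟨tmul R (HomMod.of ι φ) (LeftMod.of ι x), evMap_tmul ι M _ _⟩
  have hzero : ∀ φ : S ⟶ M, T.mkQ ∘ₗ Hom.toLin φ = 0 := fun φ =>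
    LinearMap.ext fun x => (Submodule.Quotient.mk_eq_zero T).2 (hmem φ x)
  have hT : T ≤ LinearMap.ker (rightTensorLin C T.mkQ ∘ₗ M.coact) := by
    rintro _ ⟨w, rfl⟩
    refine induction_on w ?_ (fun φ x => ?_) fun s t hs ht => ?_
    · rw [map_zero]
      exact Submodule.zero_mem _
    · obtain ⟨x, rfl⟩ : ∃ y, LeftMod.of ι y = x := ⟨x, rfl⟩
      rw [evMap_tmul, LinearMap.mem_ker]
      change rightTensor C T.mkQ (M.coact (Hom.toLin φ.hom x)) = 0
      rw [← Hom.colinear, ← rightTensor_comp, hzero, rightTensor_zero]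
    · rw [map_add]
      exact Submodule.add_mem _ hs ht
  let π : M ⟶ M.quotient hC T hT := homMk (N := M.quotient hC T hT) T.mkQ fun _ => rfl
  have hπ : π = 0 := by
    rw [isSeparator_def] at hS
    refine hS π 0 fun φ => ?_
    rw [Limits.comp_zero]
    exact Subtype.ext (hzero φ)
  intro m
  have hm : T.mkQ m = 0 := congrArg (fun f => Hom.toLin f m) hπ
  exact (Submodule.Quotient.mk_eq_zero T).1 hm

variable {ι : R →ₙ+* End S}

/-- The coordinatewise coaction on `S^n`. -/
def powCoact (S : Comod A C) (n : ℕ) :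
    (Fin n → S.carrier) →ₗ[Aᵐᵒᵖ] BTensor A (Fin n → S.carrier) C :=
  ∑ i, rightTensorLin C (LinearMap.single Aᵐᵒᵖ (fun _ => S.carrier) i) ∘ₗ S.coact ∘ₗ
    LinearMap.proj i

theorem rightTensor_proj_powCoact (n : ℕ) (v : Fin n → S.carrier) (i : Fin n) :
    rightTensor C (LinearMap.proj (R := Aᵐᵒᵖ) i) (powCoact S n v) = S.coact (v i) := by
  rw [powCoact, LinearMap.sum_apply, map_sum, Finset.sum_eq_single i]
  · change rightTensor C _ (rightTensor C _ (S.coact (v i))) = _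
    rw [← rightTensor_comp, LinearMap.proj_comp_single_same, rightTensor_id]
  · intro k _ hk
    change rightTensor C _ (rightTensor C _ (S.coact (v k))) = _
    rw [← rightTensor_comp, LinearMap.proj_comp_single_ne _ _ _ _ hk.symm, rightTensor_zero]
  · simp

theorem rightContract_powCoact (n : ℕ) (v : Fin n → S.carrier) (g : C →ₗ[A] A) :
    rightContract _ g (powCoact S n v) = fun i => S.act (v i) g := by
  ext i
  rw [act, ← rightTensor_proj_powCoact, rightContract_rightTensor]
  rfl

theorem exists_comod_of_submodule (hC : IsWeaklyLocallyProjective A C) {M : Type u}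
    [AddCommGroup M] [Module Aᵐᵒᵖ M] (τ : M →ₗ[Aᵐᵒᵖ] BTensor A M C) (K : Submodule Aᵐᵒᵖ M)
    (hK : ∀ v ∈ K, ∀ g, rightContract M g (τ v) ∈ K)
    (hmul : ∀ g h, ∀ v ∈ K, rightContract M h (τ (rightContract M g (τ v))) =
      rightContract M (starMul g h) (τ v))
    (hone : ∀ v ∈ K, rightContract M CoringStruct.counit (τ v) = v) :
    ∃ (N : Comod A C) (e : N.carrier →ₗ[Aᵐᵒᵖ] M),
      (∀ k, rightTensor C e (N.coact k) = τ (e k)) ∧ ∀ v, v ∈ K ↔ ∃ k, e k = v := by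
  obtain ⟨κ, hκ⟩ := Comodule.exists_of_submodule hC K (fun k => τ k)
    (fun k g => hK k k.2 g)
    (fun k k' => by rw [Submodule.coe_add, map_add])
    (fun a k => by rw [Submodule.coe_smul, map_smul])
    (fun g h k => hmul g h k k.2) (fun k => hone k k.2)
  exact ⟨{ carrier := K, comodule := κ }, K.subtype, hκ,
    fun v => ⟨fun hv => ⟨⟨v, hv⟩, rfl⟩, fun ⟨k, hk⟩ => hk ▸ k.2⟩⟩

/-- If every right comodule is generated by `S`, then a submodule of `S^n` that is stable under
the action of `*C` is generated by the `n`-tuples of endomorphisms of `S` with values in it. -/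
theorem exists_generators_of_submodule_pow (hC : IsWeaklyLocallyProjective A C)
    (hsurj : ∀ M : Comod A C, Function.Surjective (evMap ι M)) {n : ℕ}
    (K : Submodule Aᵐᵒᵖ (Fin n → S.carrier))
    (hK : ∀ v ∈ K, ∀ g : C →ₗ[A] A, (fun i => S.act (v i) g) ∈ K)
    {p : (Fin n → S.carrier) → Prop} (h0 : p 0) (hadd : ∀ v w, p v → p w → p (v + w))
    (hgen : ∀ ψ : Fin n → (S ⟶ S), (∀ x, (fun i => Hom.toLin (ψ i) x) ∈ K) →
      ∀ x, p fun i => Hom.toLin (ψ i) x) {v : Fin n → S.carrier} (hv : v ∈ K) : p v := by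
  -- `K` becomes a comodule `N` generated by `S`; composing a morphism `S ⟶ N` with the coordinate
  -- projections gives the tuples `ψ`.
  obtain ⟨N, e, he, heK⟩ := exists_comod_of_submodule hC (powCoact S n) K
    (fun v hv g => by
      rw [rightContract_powCoact]
      exact hK v hv g)
    (fun g h v _ => by simp only [rightContract_powCoact, act_act])
    (fun v _ => by
      rw [rightContract_powCoact]
      exact funext fun i => act_counit S _)
  have hpr : ∀ i, ∃ f : N ⟶ S, ∀ k, Hom.toLin f k = e k i := by
    intro i
    let q : (Fin n → S.carrier) →ₗ[Aᵐᵒᵖ] S.carrier := LinearMap.proj i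
    have hq : ∀ v, rightTensor C q (powCoact S n v) = S.coact (v i) := fun v =>
      rightTensor_proj_powCoact n v i
    refine ⟨homMk (q ∘ₗ e) fun k => ?_, fun k => rfl⟩
    rw [rightTensor_comp, he, hq]
    rfl
  choose pr hpr using hpr
  have key : ∀ w, p (e (evMap ι N w)) := by
    intro w
    refine induction_on w (by rw [map_zero, map_zero]; exact h0) (fun ψ x => ?_)
      fun s t hs ht => ?_
    · rw [evMap_tmul]
      have h1 : ∀ y, (fun i => Hom.toLin (ψ.hom ≫ pr i) y) = e (Hom.toLin ψ.hom y) := fun y =>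
        funext fun i => hpr i _
      obtain ⟨x, rfl⟩ : ∃ y, LeftMod.of ι y = x := ⟨x, rfl⟩
      rw [HomMod.toAddHom_of, ← h1]
      refine hgen (fun i => ψ.hom ≫ pr i) (fun y => ?_) x
      rw [h1, heK]
      exact ⟨_, rfl⟩
    · rw [map_add, map_add]
      exact hadd _ _ hs ht
  obtain ⟨k, rfl⟩ := (heK v).1 hv
  obtain ⟨w, rfl⟩ := hsurj N k
  exact key w

/-- If `S` generates all comodules, then `X ⊗_R S` embeds into a product of copies of `M` as soon
as `X` maps, with kernel annihilated by `R`, into a product of copies of `Hom^C(S, M)`. -/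
theorem tensor_eq_zero_of_evMap_eq_zero (hC : IsWeaklyLocallyProjective A C)
    (hideal : ∀ (r : R) (t : End S), ∃ r' : R, ι r' = ι r * t)
    (hS : IsFirmLeft R (LeftMod ι))
    (hsurj : ∀ M : Comod A C, Function.Surjective (evMap ι M))
    {X : Type u} [AddCommGroup X] [NonUnitalModule Rᵐᵒᵖ X] (M : Comod A C) {κ : Type*}
    (j : κ → X →+ HomMod ι M) (hj : ∀ k (r : R) x, j k (op r • x) = op r • j k x)
    (hker : ∀ x, (∀ k, j k x = 0) → ∀ r : R, op r • x = 0) (z : BTensor R X (LeftMod ι))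
    (hz : ∀ k, evMap ι M (rTensor (LeftMod ι) (j k) (hj k) z) = 0) : z = 0 := by
  obtain ⟨n, x, r, s, rfl⟩ := hS.exists_eq_sum z
  have hlin : ∀ k i, ∃ f : S ⟶ M, ∀ y : S.carrier, Hom.toLin f y =
      (j k (x i)).toAddHom (r i • LeftMod.of ι y) :=
    fun k i => ⟨HomMod.hom (op (r i) • j k (x i)), fun y => rfl⟩
  choose f hf using hlin
  -- `K` holds all tuples satisfying the relations that `hz` imposes on `s`. The tensor is shown to
  -- vanish for every tuple in `K`, and for this it is enough to treat values of tuples of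
  -- endomorphisms.
  let K : Submodule Aᵐᵒᵖ (Fin n → S.carrier) :=
    ⨅ k, LinearMap.ker (∑ i, Hom.toLin (f k i) ∘ₗ LinearMap.proj i)
  have hKmem : ∀ v, v ∈ K ↔ ∀ k, ∑ i, Hom.toLin (f k i) (v i) = 0 := fun v => by
    simp [K, Submodule.mem_iInf]
  refine exists_generators_of_submodule_pow (ι := ι) hC hsurj K ?_
    (p := fun v => ∑ i, tmul R (x i) (r i • LeftMod.of ι (v i)) = 0) ?_ ?_ ?_ (v := s) ?_
  · intro v hv g
    rw [hKmem] at hv ⊢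
    intro k
    have h1 : ∀ i, Hom.toLin (f k i) (S.act (v i) g) =
        rightContract _ g (M.coact (Hom.toLin (f k i) (v i))) := fun i => toLin_act _ _ _
    simp only [h1, ← map_sum]
    rw [hv k, map_zero, map_zero]
  · refine Finset.sum_eq_zero fun i _ => ?_
    refine (congrArg (tmul R (x i)) (smul_zero (A := LeftMod ι) (r i))).trans (tmul_zero _)
  · intro v w hv hw
    refine Eq.trans ?_ ((congrArg₂ (· + ·) hv hw).trans (add_zero 0))
    rw [← Finset.sum_add_distrib]
    refine Finset.sum_congr rfl fun i _ => ?_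
    refine (congrArg _ (smul_add (r i) (LeftMod.of ι (v i)) (LeftMod.of ι (w i)))).trans
      (tmul_add _ _ _)
  · intro ψ hψ y
    -- The right ideal property replaces `r i ∘ ψ i` by an element of `R`, which then crosses the
    -- tensor sign.
    choose ρ hρ using fun i => hideal (r i) (ψ i)
    have h1 : ∀ i (y : S.carrier),
        r i • LeftMod.of ι (Hom.toLin (ψ i) y) = ρ i • LeftMod.of ι y := fun i y =>
      (congrArg (fun φ => Hom.toLin φ y) (hρ i)).symm
    have h2 : ∑ i, tmul R (x i) (r i • LeftMod.of ι (Hom.toLin (ψ i) y)) =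
        tmul R (∑ i, op (ρ i) • x i) (LeftMod.of ι y) := by
      rw [sum_tmul]
      refine Finset.sum_congr rfl fun i _ => ?_
      rw [BTensor.smul_tmul]
      exact congrArg _ (h1 i y)
    -- Because `ψ` takes values in `K`, every `j k` kills `∑ xᵢ ρᵢ`, so `R` annihilates this
    -- element.
    refine h2.trans (hS.tmul_eq_zero (hker _ fun k => HomMod.ext fun y => ?_) y)
    obtain ⟨y, rfl⟩ : ∃ y', LeftMod.of ι y' = y := ⟨y, rfl⟩
    have h3 := (hKmem _).1 (hψ y) k
    refine Eq.trans ?_ h3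
    let ev : HomMod ι M →+ M.carrier := (evMap ι M).comp ((BTensor.mk R _ _).flip (LeftMod.of ι y))
    have hev : ∀ φ, ev φ = φ.toAddHom (LeftMod.of ι y) := fun φ => evMap_tmul ι M φ _
    rw [map_sum, ← hev, map_sum]
    refine Finset.sum_congr rfl fun i _ => ?_
    rw [hev, hj, HomMod.toAddHom_smul, hf]
    exact congrArg _ (h1 i y).symm
  · refine (hKmem _).2 fun k => ?_
    have h1 := hz k
    rw [map_sum, map_sum] at h1
    rw [← h1]
    refine Finset.sum_congr rfl fun i _ => ?_
    rw [rTensor_tmul, evMap_tmul]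
    exact hf k i _

end Generator

/-! ### The canonical map of a generator. -/

section Galois

variable {A C R : Type u} [Ring A] [AddCommGroup C] [Module A C] [Module Aᵐᵒᵖ C]
  [SMulCommClass A Aᵐᵒᵖ C] [Coring A C] [NonUnitalRing R] {S : Comod A C}

open Comod

variable {ι : R →ₙ+* End S}

/-- The map `φ ↦ (x ↦ φ(x₀) ⊗ x₁)` from `Hom_A(S, M)` to `Hom^C(S, M ⊗_A C)`. -/
def LinMod.toCofree (hC : IsWeaklyLocallyProjective A C) (ι : R →ₙ+* End S) (M : Type u)
    [AddCommGroup M] [Module Aᵐᵒᵖ M] : LinMod ι M →+ HomMod ι (cofree M hC) :=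
  AddMonoidHom.mk' (fun φ => HomMod.of ι (Comod.toCofree hC (LinMod.toLin φ)))
    (fun φ ψ => HomMod.ext fun x => rightTensor_add (LinMod.toLin φ) (LinMod.toLin ψ) (S.coact x))

theorem LinMod.toAddHom_toCofree (hC : IsWeaklyLocallyProjective A C) {M : Type u}
    [AddCommGroup M] [Module Aᵐᵒᵖ M] (φ : LinMod ι M) (x : LeftMod ι) :
    (LinMod.toCofree hC ι M φ).toAddHom x = rightTensor C (LinMod.toLin φ) (S.coact x) := rfl

theorem LinMod.toCofree_smul (hC : IsWeaklyLocallyProjective A C) {M : Type u}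
    [AddCommGroup M] [Module Aᵐᵒᵖ M] (r : R) (φ : LinMod ι M) :
    LinMod.toCofree hC ι M (op r • φ) = op r • LinMod.toCofree hC ι M φ := by
  refine HomMod.ext fun x => ?_
  rw [HomMod.toAddHom_smul, toAddHom_toCofree, toAddHom_toCofree]
  refine (rightTensor_comp (Hom.toLin (ι r)) (LinMod.toLin φ) (S.coact x)).trans ?_
  exact congrArg _ (Hom.colinear (ι r : S ⟶ S) x)

/-- The counit recovers `φ(x)` from `φ(x₀) ⊗ x₁`. -/
theorem LinMod.toCofree_injective (hC : IsWeaklyLocallyProjective A C) {M : Type u}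
    [AddCommGroup M] [Module Aᵐᵒᵖ M] {φ : LinMod ι M} (h : LinMod.toCofree hC ι M φ = 0) :
    φ = 0 := by
  refine LinearMap.ext fun x => ?_
  have h1 : rightTensor C (LinMod.toLin φ) (S.coact x) = 0 :=
    congrArg (fun ψ => ψ.toAddHom (LeftMod.of ι x)) h
  have h2 : LinMod.toLin φ (S.act x CoringStruct.counit) = 0 := by
    rw [act, ← rightContract_rightTensor, h1, map_zero]
  rwa [act_counit] at h2

/-- The canonical map is evaluation on a cofree comodule, once `Hom_A(S, M)` is read as `Hom^C(S, M
⊗_A C)`. This is how the Galois property reduces to evaluation maps. -/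
theorem evMap_toCofree (hC : IsWeaklyLocallyProjective A C) (M : Type u)
    [AddCommGroup M] [Module Aᵐᵒᵖ M] (z : BTensor R (LinMod ι M) (LeftMod ι)) :
    evMap ι (cofree M hC) (rTensor _ (LinMod.toCofree hC ι M) (LinMod.toCofree_smul hC) z) =
      canMap ι M z := by
  refine hom_congr (f := (evMap ι (cofree M hC)).comp (rTensor _ (LinMod.toCofree hC ι M)
    (LinMod.toCofree_smul hC))) (g := canMap ι M) (fun φ x => ?_) z
  rw [AddMonoidHom.comp_apply, rTensor_tmul, evMap_tmul]
  exact (canMap_tmul ι M φ x).symm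

theorem isComonadicGalois_of_evMap_surjective (hC : IsWeaklyLocallyProjective A C)
    (hideal : ∀ (r : R) (t : End S), ∃ r' : R, ι r' = ι r * t)
    (hS : IsFirmLeft R (LeftMod ι))
    (hsurj : ∀ M : Comod A C, Function.Surjective (evMap ι M)) : IsComonadicGalois ι := by
  intro M _ _
  constructor
  · rw [injective_iff_map_eq_zero]
    intro z hz
    refine tensor_eq_zero_of_evMap_eq_zero hC hideal hS hsurj (cofree M hC) (κ := Unit)
      (fun _ => LinMod.toCofree hC ι M) (fun _ => LinMod.toCofree_smul hC)
      (fun φ hφ r => ?_) z (fun _ => ?_)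
    · rw [LinMod.toCofree_injective hC (hφ ()), smul_zero]
    · rw [evMap_toCofree, hz]
      rfl
  · intro y
    obtain ⟨w, rfl⟩ := hsurj (cofree M hC) y
    refine induction_on w ⟨0, by rw [map_zero, map_zero]; rfl⟩ (fun φ x => ?_) ?_
    -- The preimage uses the adjunct `(M ⊗ ε) ∘ φ` of `φ`.
    · refine ⟨tmul R (show LinMod ι M from counitContract C M ∘ₗ Hom.toLin φ.hom) x, ?_⟩
      rw [evMap_tmul, canMap_tmul]
      obtain ⟨x, rfl⟩ : ∃ y, LeftMod.of ι y = x := ⟨x, rfl⟩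
      refine (rightTensor_comp (Hom.toLin φ.hom) (counitContract C M) (S.coact x)).trans ?_
      rw [Hom.colinear]
      exact rightTensor_counitContract_cofreeCoact M _
    · rintro s t ⟨a, ha⟩ ⟨b, hb⟩
      refine ⟨a + b, ?_⟩
      rw [map_add, ha, hb, map_add]
      rfl

end Galois

/-! ### Flatness of a generator. -/

section Flat

variable {A C R : Type u} [Ring A] [AddCommGroup C] [Module A C] [Module Aᵐᵒᵖ C]
  [SMulCommClass A Aᵐᵒᵖ C] [Coring A C] [NonUnitalRing R] {S : Comod A C}

open Comod

section FreeCover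

variable (R) (Y : Type u)

/-- The free right module on the underlying set of `Y`, over the unitization of `R`. -/
def FreeCover : Type u := Y →₀ Unitization ℤ R

noncomputable instance : AddCommGroup (FreeCover R Y) :=
  inferInstanceAs (AddCommGroup (Y →₀ Unitization ℤ R))

/-- The coordinates of an element of the free cover. -/
def FreeCover.coord (y : Y) : FreeCover R Y →+ Unitization ℤ R := Finsupp.applyAddHom y

variable {R Y} in
theorem FreeCover.ext {f g : FreeCover R Y} (h : ∀ y, coord R Y y f = coord R Y y g) : f = g :=
  Finsupp.ext h

noncomputable instance : SMul Rᵐᵒᵖ (FreeCover R Y) where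
  smul r f := DistribSMul.toAddMonoidHom (Y →₀ Unitization ℤ R) 
    (op (Unitization.inr r.unop : Unitization ℤ R)) f

theorem FreeCover.coord_smul (y : Y) (r : Rᵐᵒᵖ) (f : FreeCover R Y) :
    coord R Y y (r • f) = coord R Y y f * Unitization.inr r.unop := rfl

noncomputable instance : NonUnitalModule Rᵐᵒᵖ (FreeCover R Y) where
  smul_zero r := FreeCover.ext fun y => by simp [FreeCover.coord_smul]
  smul_add r f g := FreeCover.ext fun y => by simp [FreeCover.coord_smul, add_mul]
  add_smul r s f := FreeCover.ext fun y => by simp [FreeCover.coord_smul, mul_add]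
  mul_smul r s f := FreeCover.ext fun y => by simp [FreeCover.coord_smul, mul_assoc]

variable [AddCommGroup Y] [NonUnitalModule Rᵐᵒᵖ Y]

/-- The map `(n, r) ↦ n y + y r`. -/
def unitizationAct (y : Y) : Unitization ℤ R →+ Y :=
  AddMonoidHom.mk' (fun a => a.fst • y + op a.snd • y) (fun a b => by
    rw [Unitization.fst_add, Unitization.snd_add, add_smul, MulOpposite.op_add,
      NonUnitalModule.add_smul]
    abel)

theorem unitizationAct_mul_inr (y : Y) (a : Unitization ℤ R) (r : R) :
    unitizationAct R Y y (a * Unitization.inr r) = op r • unitizationAct R Y y a := by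
  have h : ∀ n : ℤ, op (n • r) • y = op r • (n • y) := fun n => by
    have h1 := map_zsmul (AddMonoidHom.mk' (fun r : R => op r • y)
      (fun r s => NonUnitalModule.add_smul (op r) (op s) y)) n r
    have h2 := map_zsmul (DistribSMul.toAddMonoidHom Y (op r)) n y
    exact h1.trans h2.symm
  simp only [unitizationAct, AddMonoidHom.mk'_apply, Unitization.fst_mul, Unitization.snd_mul,
    Unitization.fst_inr, Unitization.snd_inr, mul_zero, zero_smul, zero_add, add_zero, smul_add,
    MulOpposite.op_add, NonUnitalModule.add_smul, h, MulOpposite.op_mul, NonUnitalModule.mul_smul]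

/-- The surjection from the free cover of `Y` to `Y`. -/
noncomputable def FreeCover.toModule : FreeCover R Y →+ Y := Finsupp.liftAddHom (unitizationAct R Y)

theorem FreeCover.toModule_single (y : Y) (a : Unitization ℤ R) :
    FreeCover.toModule R Y (Finsupp.single y a) = unitizationAct R Y y a :=
  Finsupp.liftAddHom_apply_single _ _ _

/-- The adjoined unit is essential: `Y` is not assumed firm, so `y` need not lie in `Y R`. -/
theorem FreeCover.toModule_surjective : Function.Surjective (FreeCover.toModule R Y) := fun y =>
  ⟨Finsupp.single y 1, by
    have h : (0 : Rᵐᵒᵖ) • y = 0 := by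
      have := NonUnitalModule.add_smul (0 : Rᵐᵒᵖ) 0 y
      rwa [add_zero, left_eq_add] at this
    rw [toModule_single]
    simp [unitizationAct, h]⟩

theorem FreeCover.toModule_smul (r : R) (f : FreeCover R Y) :
    toModule R Y (op r • f) = op r • toModule R Y f := by
  have h : (toModule R Y).comp (DistribSMul.toAddMonoidHom (FreeCover R Y) (op r)) =
      (DistribSMul.toAddMonoidHom Y (op r)).comp (toModule R Y) := by
    refine Finsupp.addHom_ext (M := Unitization ℤ R) fun y a => ?_
    have h1 : op r • (show FreeCover R Y from Finsupp.single y a) =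
        Finsupp.single y (a * Unitization.inr r) :=
      Finsupp.smul_single (op (Unitization.inr r : Unitization ℤ R)) y a
    have h2 := (congrArg (toModule R Y) h1).trans (toModule_single R Y y _)
    refine h2.trans ?_
    rw [unitizationAct_mul_inr]
    exact congrArg _ (toModule_single R Y y a).symm
  exact DFunLike.congr_fun h f

end FreeCover

/-- An additive subgroup of a right module that is stable under the action. -/
structure NonUnitalSubmodule (R M : Type u) [NonUnitalRing R] [AddCommGroup M]
    [NonUnitalModule Rᵐᵒᵖ M] where
  toAddSubgroup : AddSubgroup M
  smul_mem : ∀ (r : R), ∀ x ∈ toAddSubgroup, op r • x ∈ toAddSubgroup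

instance {M : Type u} [AddCommGroup M] [NonUnitalModule Rᵐᵒᵖ M] (N : NonUnitalSubmodule R M) :
    NonUnitalModule Rᵐᵒᵖ N.toAddSubgroup where
  smul r x := ⟨r • x.1, N.smul_mem r.unop x.1 x.2⟩
  smul_zero r := Subtype.ext (smul_zero r)
  smul_add r x y := Subtype.ext (smul_add r x.1 y.1)
  add_smul r s x := Subtype.ext (NonUnitalModule.add_smul r s x.1)
  mul_smul r s x := Subtype.ext (NonUnitalModule.mul_smul r s x.1)

variable {ι : R →ₙ+* End S}

/-- The extension of `ι` to the unitization of `R`. -/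
def unitizationHom (ι : R →ₙ+* End S) : Unitization ℤ R →+ HomMod ι S :=
  AddMonoidHom.mk' (fun a => a.fst • HomMod.of ι (𝟙 S) + HomMod.of ι (ι a.snd)) (fun a b => by
    rw [Unitization.fst_add, Unitization.snd_add, add_smul, map_add]
    exact add_add_add_comm _ _ _ _)

theorem toAddHom_unitizationHom (a : Unitization ℤ R) (x : LeftMod ι) :
    (unitizationHom ι a).toAddHom x = a.fst • x + a.snd • x := by
  let ev : HomMod ι S →+ S.carrier := (evMap ι S).comp ((BTensor.mk R _ _).flip x)
  have hev : ∀ φ, ev φ = φ.toAddHom x := fun φ => evMap_tmul ι S φ x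
  rw [← hev]
  refine (map_add ev _ _).trans ?_
  rw [map_zsmul]
  rfl

theorem unitizationHom_mul_inr (a : Unitization ℤ R) (r : R) :
    unitizationHom ι (a * Unitization.inr r) = op r • unitizationHom ι a := by
  refine HomMod.ext fun x => ?_
  have h : ∀ n : ℤ, (n • r) • x = n • (r • x) := fun n => map_zsmul (AddMonoidHom.mk'
    (fun r : R => r • x) (fun r s => NonUnitalModule.add_smul r s x)) n r
  rw [HomMod.toAddHom_smul, toAddHom_unitizationHom, toAddHom_unitizationHom]
  simp only [Unitization.fst_mul, Unitization.snd_mul,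
    Unitization.fst_inr, Unitization.snd_inr, mul_zero, zero_smul, zero_add, add_zero,
    NonUnitalModule.add_smul, h, NonUnitalModule.mul_smul]
  rfl

/-- The extension of `ι` to the unitization may fail to be injective, but `a · r` lies in `R`, where
`ι` is injective. This matches the weak kernel condition of `tensor_eq_zero_of_evMap_eq_zero`. -/
theorem mul_inr_eq_zero (hι : Function.Injective ι) {a : Unitization ℤ R}
    (ha : unitizationHom ι a = 0) (r : R) : a * Unitization.inr r = 0 := by
  have h1 := unitizationHom_mul_inr (ι := ι) a r
  rw [ha, smul_zero] at h1
  have h2 : (a * Unitization.inr r).fst = 0 := by simp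
  have h3 : ι (a * Unitization.inr r).snd = ι 0 := by
    rw [map_zero]
    refine Eq.trans ?_ h1
    change _ = (a * Unitization.inr r).fst • HomMod.of ι (𝟙 S) + HomMod.of ι (ι _)
    rw [h2, zero_smul, zero_add]
    rfl
  exact Unitization.ext h2 (hι h3)

/-- The coordinates of the free cover, followed by the action of the unitization on `S`, map `X` to
a product of copies of `End S` with kernel annihilated by `R`. -/
theorem FreeCover.tensor_eq_zero (hC : IsWeaklyLocallyProjective A C)
    (hι : Function.Injective ι)
    (hideal : ∀ (r : R) (t : End S), ∃ r' : R, ι r' = ι r * t)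
    (hS : IsFirmLeft R (LeftMod ι))
    (hsurj : ∀ M : Comod A C, Function.Surjective (evMap ι M)) {X Y : Type u} [AddCommGroup X]
    [NonUnitalModule Rᵐᵒᵖ X] (i : X →+ FreeCover R Y)
    (hi : ∀ (r : R) x, i (op r • x) = op r • i x) (hinj : Function.Injective i)
    (z : BTensor R X (LeftMod ι)) (hz : rTensor (LeftMod ι) i hi z = 0) : z = 0 := by
  have hc : ∀ y (r : R) f, (unitizationHom ι).comp (coord R Y y) (op r • f) =
      op r • (unitizationHom ι).comp (coord R Y y) f := fun y r f => by
    rw [AddMonoidHom.comp_apply, coord_smul, AddMonoidHom.comp_apply]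
    exact unitizationHom_mul_inr _ _
  refine tensor_eq_zero_of_evMap_eq_zero hC hideal hS hsurj S (κ := Y)
    (fun y => ((unitizationHom ι).comp (coord R Y y)).comp i)
    (fun y r x => by rw [AddMonoidHom.comp_apply, hi, hc]; rfl)
    (fun x hx r => hinj ?_) z (fun y => ?_)
  · rw [hi, map_zero]
    refine FreeCover.ext fun y => ?_
    rw [coord_smul, map_zero]
    exact mul_inr_eq_zero hι (hx y) r
  · have h := hom_congr (f := rTensor (LeftMod ι) (((unitizationHom ι).comp (coord R Y y)).comp i)
        (fun r x => by rw [AddMonoidHom.comp_apply, hi, hc]; rfl))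
      (g := (rTensor (LeftMod ι) _ (hc y)).comp (rTensor (LeftMod ι) i hi))
      (fun x s => by simp only [AddMonoidHom.comp_apply, rTensor_tmul]) z
    rw [h, AddMonoidHom.comp_apply, hz, map_zero, map_zero]

/-- Let `π : F → Y` be the free cover, `K = ker π` and `X' = π⁻¹(f X)`, so that `X'` maps onto `X`.
An element killed in `Y ⊗ S` lifts to `X' ⊗ S`, and its image in `F ⊗ S` comes from `K ⊗ S` by right
exactness. Since `X' ⊗ S → F ⊗ S` is injective, the lift itself comes from `K ⊗ S`, so it dies in `X
⊗ S`. -/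
theorem rTensor_injective_of_evMap_surjective (hC : IsWeaklyLocallyProjective A C)
    (hι : Function.Injective ι)
    (hideal : ∀ (r : R) (t : End S), ∃ r' : R, ι r' = ι r * t)
    (hS : IsFirmLeft R (LeftMod ι))
    (hsurj : ∀ M : Comod A C, Function.Surjective (evMap ι M)) {X Y : Type u} [AddCommGroup X]
    [AddCommGroup Y] [NonUnitalModule Rᵐᵒᵖ X] [NonUnitalModule Rᵐᵒᵖ Y] (f : X →+ Y)
    (hf : ∀ (r : R) x, f (op r • x) = op r • f x) (hinj : Function.Injective f) :
    Function.Injective (rTensor (LeftMod ι) f hf) := by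
  let π := FreeCover.toModule R Y
  have hπ := FreeCover.toModule_smul R Y
  have hπs := FreeCover.toModule_surjective R Y
  obtain ⟨X', hX'⟩ : ∃ X' : NonUnitalSubmodule R (FreeCover R Y),
      ∀ t, t ∈ X'.toAddSubgroup ↔ ∃ x, f x = π t := ⟨⟨f.range.comap π, by
    rintro r t ⟨x, hx⟩
    exact ⟨op r • x, by rw [hf, hx, hπ]⟩⟩, fun _ => Iff.rfl⟩
  obtain ⟨K, hK⟩ : ∃ K : NonUnitalSubmodule R (FreeCover R Y),
      ∀ t, t ∈ K.toAddSubgroup ↔ π t = 0 := ⟨⟨π.ker, by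
    intro r t ht
    change π (op r • t) = 0
    rw [hπ, (ht : π t = 0), smul_zero]⟩, fun _ => Iff.rfl⟩
  choose p hp using fun t : X'.toAddSubgroup => (hX' t).1 t.2
  let P : X'.toAddSubgroup →+ X := AddMonoidHom.mk' p (fun s t => hinj (by
    rw [map_add, hp, hp, hp]
    exact map_add π _ _))
  have hP : ∀ (r : R) t, P (op r • t) = op r • P t := fun r t => hinj (by
    rw [hf]
    refine (hp _).trans ((hπ r t).trans ?_)
    rw [← hp t]
    rfl)
  have hPs : Function.Surjective P := fun x => by
    obtain ⟨t, ht⟩ := hπs (f x)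
    refine ⟨⟨t, (hX' t).2 ⟨x, ht.symm⟩⟩, hinj ((hp _).trans ht)⟩
  let j : K.toAddSubgroup →+ X'.toAddSubgroup := AddSubgroup.inclusion (by
    intro t ht
    exact (hX' t).2 ⟨0, by rw [map_zero, (hK t).1 ht]⟩)
  have hj : ∀ (r : R) t, j (op r • t) = op r • j t := fun _ _ => rfl
  have hsubX : ∀ (r : R) t, X'.toAddSubgroup.subtype (op r • t) =
    op r • X'.toAddSubgroup.subtype t := fun _ _ => rfl
  have hsubK : ∀ (r : R) t, K.toAddSubgroup.subtype (op r • t) =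
    op r • K.toAddSubgroup.subtype t := fun _ _ => rfl
  rw [injective_iff_map_eq_zero]
  intro z hz
  obtain ⟨z, rfl⟩ := rTensor_surjective (hg := hP) hPs z
  have h1 := hom_congr (f := (rTensor (LeftMod ι) f hf).comp (rTensor (LeftMod ι) P hP))
    (g := (rTensor (LeftMod ι) π hπ).comp (rTensor (LeftMod ι) X'.toAddSubgroup.subtype hsubX))
    (fun t s => by
      simp only [AddMonoidHom.comp_apply, rTensor_tmul]
      exact congrArg (fun y => tmul R y s) (hp t)) z
  rw [AddMonoidHom.comp_apply, hz, AddMonoidHom.comp_apply] at h1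
  obtain ⟨k, hk⟩ := exists_rTensor_eq (f := K.toAddSubgroup.subtype) (hf := hsubK) (hg := hπ)
    hπs (fun y hy => ⟨⟨y, (hK y).2 hy⟩, rfl⟩) h1.symm
  have h2 := hom_congr (f := (rTensor (LeftMod ι) X'.toAddSubgroup.subtype hsubX).comp
      (rTensor (LeftMod ι) j hj)) (g := rTensor (LeftMod ι) K.toAddSubgroup.subtype hsubK)
    (fun t s => by
      simp only [AddMonoidHom.comp_apply, rTensor_tmul]
      rfl) k
  have h3 : z - rTensor (LeftMod ι) j hj k = 0 := by
    refine FreeCover.tensor_eq_zero hC hι hideal hS hsurj X'.toAddSubgroup.subtype hsubX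
      (AddSubgroup.subtype_injective _) _ ?_
    rw [map_sub, ← hk, ← h2, AddMonoidHom.comp_apply, sub_self]
  rw [sub_eq_zero.1 h3]
  have h4 := hom_congr (f := (rTensor (LeftMod ι) P hP).comp (rTensor (LeftMod ι) j hj))
    (g := 0) (fun t s => by
      simp only [AddMonoidHom.comp_apply, rTensor_tmul]
      have : P (j t) = 0 := hinj ((hp _).trans (by rw [map_zero]; exact (hK t).1 t.2))
      rw [this, zero_tmul]
      rfl) k
  exact h4

/-- Exactness in the middle follows by factoring `g` through its image: right exactness handles the
surjection, preservation of injections the inclusion. -/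
theorem isFlatLeft_of_evMap_surjective (hC : IsWeaklyLocallyProjective A C)
    (hι : Function.Injective ι)
    (hideal : ∀ (r : R) (t : End S), ∃ r' : R, ι r' = ι r * t)
    (hS : IsFirmLeft R (LeftMod ι))
    (hsurj : ∀ M : Comod A C, Function.Surjective (evMap ι M)) : IsFlatLeft R (LeftMod ι) := by
  intro X Y Z _ _ _ _ _ _ f g hf hg hinj hex
  refine ⟨rTensor_injective_of_evMap_surjective hC hι hideal hS hsurj f hf hinj, fun t => ?_⟩
  obtain ⟨I, hI⟩ : ∃ I : NonUnitalSubmodule R Z, I.toAddSubgroup = g.range := ⟨⟨g.range, by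
    rintro r _ ⟨y, rfl⟩
    exact ⟨op r • y, hg r y⟩⟩, rfl⟩
  let g' : Y →+ I.toAddSubgroup := g.codRestrict _ fun y => by rw [hI]; exact ⟨y, rfl⟩
  have hgs : Function.Surjective g' := fun z => by
    obtain ⟨y, hy⟩ : z.1 ∈ g.range := hI ▸ z.2
    exact ⟨y, Subtype.ext hy⟩
  have hg' : ∀ (r : R) y, g' (op r • y) = op r • g' y := fun r y => Subtype.ext (hg r y)
  have hsub : ∀ (r : R) t, I.toAddSubgroup.subtype (op r • t) =
    op r • I.toAddSubgroup.subtype t := fun _ _ => rfl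
  constructor
  · intro ht
    have h1 := hom_congr (f := rTensor (LeftMod ι) g hg)
      (g := (rTensor (LeftMod ι) I.toAddSubgroup.subtype hsub).comp (rTensor (LeftMod ι) g' hg'))
      (fun y s => by
        simp only [AddMonoidHom.comp_apply, rTensor_tmul]
        rfl) t
    rw [ht, AddMonoidHom.comp_apply] at h1
    have h2 := rTensor_injective_of_evMap_surjective hC hι hideal hS hsurj
      I.toAddSubgroup.subtype hsub (AddSubgroup.subtype_injective _)
      (h1.symm.trans (map_zero _).symm)
    exact exists_rTensor_eq (hg := hg') hgs
      (fun y hy => (hex y).1 (congrArg Subtype.val hy)) h2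
  · rintro ⟨s, rfl⟩
    refine hom_congr (f := (rTensor (LeftMod ι) g hg).comp (rTensor (LeftMod ι) f hf)) (g := 0)
      (fun x y => ?_) s
    rw [AddMonoidHom.comp_apply, rTensor_tmul, rTensor_tmul, (hex _).2 ⟨x, rfl⟩, zero_tmul]
    rfl

end Flat

/-! ### Full faithfulness of `Hom^C(S, -) ⊗_R R`. -/

section FullyFaithful

variable {A C R : Type u} [Ring A] [AddCommGroup C] [Module A C] [Module Aᵐᵒᵖ C]
  [SMulCommClass A Aᵐᵒᵖ C] [Coring A C] [NonUnitalRing R] {S : Comod A C}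

open Comod

/-- From `(x ⊗ s) r = x ⊗ s r = x s ⊗ r`. Hence `R` annihilates the kernel of `X ⊗_R R → X`. -/
theorem op_smul_eq_tmul_rightMulMap {X : Type u} [AddCommGroup X] [NonUnitalModule Rᵐᵒᵖ X]
    (r : R) (t : BTensor R X R) : op r • t = tmul R (rightMulMap R X t) r := by
  refine hom_congr (f := DistribSMul.toAddMonoidHom (BTensor R X R) (op r))
    (g := ((BTensor.mk R X R).flip r).comp (rightMulMap R X)) (fun x s => ?_) t
  rw [DistribSMul.toAddMonoidHom_apply, op_smul_tmul, AddMonoidHom.comp_apply, rightMulMap_tmul]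
  exact (BTensor.smul_tmul s x r).symm

variable {ι : R →ₙ+* End S}

/-- The evaluation map `(Hom^C(S, M) ⊗_R R) ⊗_R S → M`. -/
def counitMap (ι : R →ₙ+* End S) (M : Comod A C) :
    BTensor R (BTensor R (HomMod ι M) R) (LeftMod ι) →+ M.carrier :=
  (evMap ι M).comp (rTensor (LeftMod ι) (rightMulMap R (HomMod ι M))
    fun r => rightMulMap_smul _ (op r))

theorem counitMap_tmul (M : Comod A C) (y : BTensor R (HomMod ι M) R) (x : LeftMod ι) :
    counitMap ι M (tmul R y x) = (rightMulMap R (HomMod ι M) y).toAddHom x := by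
  rw [counitMap, AddMonoidHom.comp_apply, rTensor_tmul, evMap_tmul]

/-- Injectivity holds because the kernel of multiplication on `Hom^C(S, M) ⊗_R R` is annihilated by
`R`; surjectivity because `S = RS` and `φ(r x)` is the image of `(φ ⊗ r) ⊗ x`. -/
theorem counitMap_bijective (hC : IsWeaklyLocallyProjective A C)
    (hideal : ∀ (r : R) (t : End S), ∃ r' : R, ι r' = ι r * t)
    (hS : IsFirmLeft R (LeftMod ι))
    (hsurj : ∀ M : Comod A C, Function.Surjective (evMap ι M)) (M : Comod A C) :
    Function.Bijective (counitMap ι M) := by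
  constructor
  · rw [injective_iff_map_eq_zero]
    intro z hz
    refine tensor_eq_zero_of_evMap_eq_zero hC hideal hS hsurj M (κ := Unit)
      (fun _ => rightMulMap R (HomMod ι M)) (fun _ r => rightMulMap_smul _ (op r))
      (fun y hy r => ?_) z (fun _ => hz)
    rw [op_smul_eq_tmul_rightMulMap, hy (), zero_tmul]
  · intro m
    obtain ⟨w, rfl⟩ := hsurj M m
    change _ ∈ (counitMap ι M).range
    refine induction_on w (by rw [map_zero]; exact zero_mem _) (fun φ x => ?_)
      fun s t hs ht => by rw [map_add]; exact add_mem hs ht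
    refine hS.induction (p := fun x => evMap ι M (tmul R φ x) ∈ (counitMap ι M).range) x
      (by rw [tmul_zero, map_zero]; exact zero_mem _) (fun r x => ⟨tmul R (tmul R φ r) x, ?_⟩)
      fun x y hx hy => by rw [tmul_add, map_add]; exact add_mem hx hy
    rw [counitMap_tmul, rightMulMap_tmul, evMap_tmul]
    rfl

theorem coinvFunctor_map_tmul (hR : IsFirmRing R) {M N : Comod A C} (f : M ⟶ N)
    (φ : HomMod ι M) (r : R) :
    ((coinvFunctor hR ι).map f).1 (tmul R φ r) = tmul R (HomMod.map ι f φ) r :=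
  rTensor_tmul (HomMod.map ι f) (HomMod.map_smul ι f) φ r

/-- Multiplying out `φ ⊗ r` shows that `f ∘ φ` and `g ∘ φ` agree on `RS`, which is all of `S`. -/
theorem coinvFunctor_faithful (hR : IsFirmRing R) (hS : IsFirmLeft R (LeftMod ι))
    (hsep : IsSeparator S) : (coinvFunctor hR ι).Faithful where
  map_injective {M N f g} hfg := by
    rw [isSeparator_def] at hsep
    refine hsep f g fun φ => HomMod.ext (ι := ι) (φ := HomMod.map ι f (HomMod.of ι φ))
      (ψ := HomMod.map ι g (HomMod.of ι φ)) fun x => ?_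
    refine hS.induction (p := fun x => (HomMod.map ι f (HomMod.of ι φ)).toAddHom x =
      (HomMod.map ι g (HomMod.of ι φ)).toAddHom x) x (by rw [map_zero, map_zero])
      (fun r x => ?_) fun x y hx hy => by rw [map_add, map_add, hx, hy]
    have h : tmul R (HomMod.map ι f (HomMod.of ι φ)) r =
        tmul R (HomMod.map ι g (HomMod.of ι φ)) r := by
      rw [← coinvFunctor_map_tmul hR, hfg, coinvFunctor_map_tmul hR]
    have h2 := congrArg (fun y => (rightMulMap R (HomMod ι N) y).toAddHom x) h
    simp only [rightMulMap_tmul] at h2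
    exact h2

theorem coinvFunctor_full (hC : IsWeaklyLocallyProjective A C) (hR : IsFirmRing R)
    (hideal : ∀ (r : R) (t : End S), ∃ r' : R, ι r' = ι r * t)
    (hS : IsFirmLeft R (LeftMod ι))
    (hsurj : ∀ M : Comod A C, Function.Surjective (evMap ι M)) : (coinvFunctor hR ι).Full where
  map_surjective {M N} α := by
    obtain ⟨a, ha⟩ : ∃ a : BTensor R (HomMod ι M) R →+ BTensor R (HomMod ι N) R, a = α.1 :=
      ⟨_, rfl⟩
    have ha' : ∀ (r : R) y, a (op r • y) = op r • a y := by rw [ha]; exact α.2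
    have hbij := counitMap_bijective hC hideal hS hsurj M
    let e := AddEquiv.ofBijective _ hbij
    -- The preimage of `α` is forced by the counits: tensor `α` with `S` and conjugate.
    -- `A`-linearity and colinearity are not formal, since `α` is only `R`-linear; they are checked
    -- on the values of morphisms from `S`.
    let f₀ : M.carrier →+ N.carrier :=
      ((counitMap ι N).comp (rTensor (LeftMod ι) a ha')).comp e.symm.toAddMonoidHom
    have hf₀ : ∀ y (x : S.carrier),
        f₀ (Hom.toLin (rightMulMap R (HomMod ι M) y).hom x) =
          Hom.toLin (rightMulMap R (HomMod ι N) (a y)).hom x := fun y x => by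
      have h1 : e.symm (Hom.toLin (rightMulMap R (HomMod ι M) y).hom x) =
          tmul R y (LeftMod.of ι x) := by
        rw [AddEquiv.symm_apply_eq]
        exact (counitMap_tmul M y (LeftMod.of ι x)).symm
      change counitMap ι N (rTensor (LeftMod ι) a ha' (e.symm _)) = _
      rw [h1, rTensor_tmul, counitMap_tmul]
      rfl
    have hind : ∀ {p : M.carrier → Prop}, p 0 →
        (∀ y (x : S.carrier), p (Hom.toLin (rightMulMap R (HomMod ι M) y).hom x)) →
        (∀ m m', p m → p m' → p (m + m')) → ∀ m, p m := by
      intro p h0 h1 h2 m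
      obtain ⟨t, rfl⟩ := hbij.2 m
      refine induction_on t (by rwa [map_zero]) (fun y x => ?_)
        fun s t hs ht => by rw [map_add]; exact h2 _ _ hs ht
      rw [counitMap_tmul]
      exact h1 y x
    let f : M.carrier →ₗ[Aᵐᵒᵖ] N.carrier :=
      { f₀ with
        map_smul' := fun b m => by
          refine hind (p := fun m => f₀ (b • m) = b • f₀ m) (by simp) (fun y x => ?_)
            (fun m m' h h' => by rw [smul_add, map_add, h, h', map_add, smul_add]) m
          rw [← map_smul, hf₀, hf₀, map_smul] }
    have hf : ∀ y (x : S.carrier),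
        f (Hom.toLin (rightMulMap R (HomMod ι M) y).hom x) =
          Hom.toLin (rightMulMap R (HomMod ι N) (a y)).hom x := hf₀
    have hcol : ∀ m, rightTensor C f (M.coact m) = N.coact (f m) := by
      refine hind (by simp only [map_zero]) (fun y x => ?_)
        fun m m' h h' => by simp only [map_add, h, h']
      rw [hf, ← Hom.colinear, ← Hom.colinear, ← rightTensor_comp]
      congr 2
      exact LinearMap.ext (hf y)
    refine ⟨homMk f hcol, Subtype.ext (hom_ext fun φ r => ?_)⟩
    refine (coinvFunctor_map_tmul hR (homMk f hcol) φ r).trans ?_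
    rw [← ha]
    -- As `R = R²`, it is enough to treat `φ ⊗ s r = (φ ⊗ s) r`, whose image under `a` depends only
    -- on the product of `a (φ ⊗ s)` in `Hom^C(S, N)`.
    obtain ⟨t, rfl⟩ := hR.2 r
    refine hom_congr (f := (BTensor.mk R _ _ (HomMod.map ι (homMk f hcol) φ)).comp
      (rightMulMap R R))
      (g := a.comp ((BTensor.mk R _ _ φ).comp (rightMulMap R R))) (fun s r => ?_) t
    simp only [AddMonoidHom.comp_apply, rightMulMap_tmul, mk_apply]
    rw [← op_smul_tmul, ← op_smul_tmul, ha', op_smul_eq_tmul_rightMulMap,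
      op_smul_eq_tmul_rightMulMap, rightMulMap_tmul]
    congr 1
    refine HomMod.ext fun x => ?_
    have h := hf (tmul R φ s) x
    rw [rightMulMap_tmul] at h
    exact h

theorem isSeparator_of_faithful (hR : IsFirmRing R) (h : (coinvFunctor hR ι).Faithful) :
    IsSeparator S := by
  rw [isSeparator_def]
  intro M N f g hfg
  refine h.map_injective (Subtype.ext (hom_ext fun φ r => ?_))
  exact ((coinvFunctor_map_tmul hR f φ r).trans
    (congrArg (fun ψ => tmul R (HomMod.of ι ψ) r) (hfg φ.hom))).trans
    (coinvFunctor_map_tmul hR g φ r).symm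

end FullyFaithful

/-! ### The module `Q` and the rational dual. -/

section Morita

variable {A C R : Type u} [Ring A] [AddCommGroup C] [Module A C] [Module Aᵐᵒᵖ C]
  [SMulCommClass A Aᵐᵒᵖ C] [Coring A C] [NonUnitalRing R] {S : Comod A C}

open Comod

variable {ι : R →ₙ+* End S}

/-- The elements of `Q` are the maps `S → *C` that respect the actions of `*C`. -/
theorem mem_moritaQ_iff_act (hC : IsWeaklyLocallyProjective A C) (q : LinMod ι (C →ₗ[A] A)) :
    q ∈ moritaQ ι ↔ ∀ (x : S.carrier) (g : C →ₗ[A] A),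
      starMul (LinMod.toLin q x) g = LinMod.toLin q (S.act x g) := by
  rw [mem_moritaQ]
  -- Applying `g` to the two sides of the defining equation in `C` gives `q(x · g)(c)` and `(q(x) *
  -- g)(c)`; functionals separate the elements of `C`.
  have key : ∀ (x : S.carrier) (g : C →ₗ[A] A) (c : C),
      g (leftContract C (evalDual A c ∘ₗ LinMod.toLin q) (S.coact x)) =
        LinMod.toLin q (S.act x g) c := fun x g c => apply_leftContract _ _ _
  constructor
  · intro h x g
    ext c
    rw [← key, h x c]
    rfl
  · intro h x c
    refine hC.ext_dual fun g => ?_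
    rw [key, ← h]
    rfl

theorem exists_comod_ratDual (hC : IsWeaklyLocallyProjective A C) :
    ∃ (N : Comod A C) (e : N.carrier →ₗ[Aᵐᵒᵖ] (C →ₗ[A] A)),
      (∀ n g, starMul (e n) g = e (N.act n g)) ∧ ∀ f ∈ ratDual A C, ∃ n, e n = f := by
  obtain ⟨κ, hκ⟩ := isRational_ratDual hC
  exact ⟨{ carrier := ratDual A C, comodule := κ }, (ratDual A C).subtype, hκ,
    fun f hf => ⟨⟨f, hf⟩, rfl⟩⟩

/-- From `q(x) * g = q(x · g) = q(x₀) g(x₁)`, the tensor `q(x₀) ⊗ x₁` witnesses rationality of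
`q(x)`. -/
theorem range_moritaMap_le (hC : IsWeaklyLocallyProjective A C) :
    (moritaMap ι).range ≤ (ratDual A C).toAddSubgroup := by
  rintro _ ⟨w, rfl⟩
  refine induction_on w (by rw [map_zero]; exact zero_mem _) (fun q x => ?_)
    fun s t hs ht => by rw [map_add]; exact add_mem hs ht
  obtain ⟨x, rfl⟩ : ∃ y, LeftMod.of ι y = x := ⟨x, rfl⟩
  rw [moritaMap_tmul, ratDual_eq hC]
  refine ⟨rightTensor C (LinMod.toLin q.1) (S.coact x), fun g => ?_⟩
  rw [rightContract_rightTensor]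
  exact (mem_moritaQ_iff_act hC q.1).1 q.2 x g

/-- `Rat(*C)` is itself a comodule, so `S` generates it, and a morphism from `S` into it followed by
the inclusion belongs to `Q`. -/
theorem range_moritaMap_of_evMap_surjective (hC : IsWeaklyLocallyProjective A C)
    (hsurj : ∀ M : Comod A C, Function.Surjective (evMap ι M)) :
    (moritaMap ι).range = (ratDual A C).toAddSubgroup := by
  refine le_antisymm (range_moritaMap_le hC) fun f hf => ?_
  obtain ⟨N, e, he, hN⟩ := exists_comod_ratDual hC
  obtain ⟨n, rfl⟩ := hN f hf
  obtain ⟨w, rfl⟩ := hsurj N n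
  refine induction_on w (by rw [map_zero, map_zero]; exact zero_mem _) (fun ψ x => ?_)
    fun s t hs ht => by rw [map_add, map_add]; exact add_mem hs ht
  let q : LinMod ι (C →ₗ[A] A) := e ∘ₗ Hom.toLin ψ.hom
  have hq : q ∈ moritaQ ι := (mem_moritaQ_iff_act hC q).2 fun x g => by
    refine (he (Hom.toLin ψ.hom x) g).trans ?_
    rw [← toLin_act]
    rfl
  refine ⟨tmul R ⟨q, hq⟩ x, ?_⟩
  rw [moritaMap_tmul, evMap_tmul]
  rfl

theorem evMap_surjective_of_range_moritaMap (hC : IsWeaklyLocallyProjective A C)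
    (hdense : @Dense (C →ₗ[A] A) (finiteTopology A C) (ratDual A C))
    (h : (moritaMap ι).range = (ratDual A C).toAddSubgroup) (M : Comod A C) :
    Function.Surjective (evMap ι M) := by
  intro m
  obtain ⟨s, hs⟩ := exists_finset_contract_eq (M.coact m)
  -- Density gives a rational `e` agreeing with `ε` on the finitely many elements of `C` that matter
  -- for `m`: a local unit, `m · e = m`.
  obtain ⟨e, he, hes⟩ := exists_mem_ratDual_eqOn hdense CoringStruct.counit s
  have hme : M.act m e = m := (hs _ _ hes).trans (M.act_counit m)
  have he' : e ∈ (moritaMap ι).range := by rw [h]; exact he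
  obtain ⟨w, rfl⟩ := he'
  rw [← hme]
  have hadd : ∀ f g, M.act m (f + g) = M.act m f + M.act m g := fun f g =>
    rightContract_add f g _
  change _ ∈ (evMap ι M).range
  refine induction_on w ?_ (fun q x => ?_)
    fun s t hs ht => by rw [map_add, hadd]; exact add_mem hs ht
  · have h0 := hadd 0 0
    rw [add_zero, left_eq_add] at h0
    rw [map_zero, h0]
    exact zero_mem _
  -- Since `q` respects the action of `*C`, so does `x ↦ m · q(x)`; it is therefore colinear, with
  -- value `m · q(x)` at `x`.
  · let φ : S.carrier →ₗ[Aᵐᵒᵖ] M.carrier :=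
      { toFun := fun x => M.act m (LinMod.toLin q.1 x)
        map_add' := fun x y => by rw [map_add, hadd]
        map_smul' := fun a x => by
          rw [map_smul]
          exact op_smul_rightContract a _ _ }
    have hφ := colinear_of_act hC φ fun x g => by
      change M.act m (LinMod.toLin q.1 (S.act x g)) = M.act (M.act m (LinMod.toLin q.1 x)) g
      rw [← (mem_moritaQ_iff_act hC q.1).1 q.2, act_act]
    refine ⟨tmul R (HomMod.of ι (homMk φ hφ)) x, ?_⟩
    rw [evMap_tmul, moritaMap_tmul]
    rfl

end Morita

/-! ### From flatness and the Galois property to generation. -/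

section Descent

variable {A C R : Type u} [Ring A] [AddCommGroup C] [Module A C] [Module Aᵐᵒᵖ C]
  [SMulCommClass A Aᵐᵒᵖ C] [Coring A C] [NonUnitalRing R] {S : Comod A C}

open Comod

variable {ι : R →ₙ+* End S}

/-- The inclusion of `Hom^C(S, M)` into `Hom_A(S, M)`. -/
def HomMod.toLinMod (ι : R →ₙ+* End S) (M : Comod A C) : HomMod ι M →+ LinMod ι M.carrier :=
  AddMonoidHom.mk' (fun φ => (Hom.toLin φ.hom : S.carrier →ₗ[Aᵐᵒᵖ] M.carrier)) fun _ _ => rfl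

/-- The map `φ ↦ ρ ∘ φ - (φ ⊗ C) ∘ ρ` from `Hom_A(S, M)` to `Hom_A(S, M ⊗_A C)`, whose kernel is
`Hom^C(S, M)`. -/
def colinearDefect (hC : IsWeaklyLocallyProjective A C) (ι : R →ₙ+* End S) (M : Comod A C) :
    LinMod ι M.carrier →+ LinMod ι (BTensor A M.carrier C) :=
  AddMonoidHom.mk' (fun φ => (M.coact ∘ₗ LinMod.toLin φ : S.carrier →ₗ[Aᵐᵒᵖ] _)) (fun φ ψ =>
    LinearMap.comp_add (LinMod.toLin φ) (LinMod.toLin ψ) M.coact) -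
  (HomMod.toLinMod ι (cofree M.carrier hC)).comp (LinMod.toCofree hC ι M.carrier)

theorem colinearDefect_apply (hC : IsWeaklyLocallyProjective A C) (M : Comod A C)
    (φ : LinMod ι M.carrier) (x : S.carrier) :
    LinMod.toLin (colinearDefect hC ι M φ) x =
      M.coact (LinMod.toLin φ x) - rightTensor C (LinMod.toLin φ) (S.coact x) := rfl

theorem colinearDefect_smul (hC : IsWeaklyLocallyProjective A C) (M : Comod A C) (r : R)
    (φ : LinMod ι M.carrier) :
    colinearDefect hC ι M (op r • φ) = op r • colinearDefect hC ι M φ := by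
  refine LinearMap.ext fun x => ?_
  refine (colinearDefect_apply hC M (op r • φ) x).trans
    (Eq.trans ?_ (colinearDefect_apply hC M φ (Hom.toLin (ι r) x)).symm)
  congr 1
  exact congrArg (fun ψ => ψ.toAddHom (LeftMod.of ι x)) (LinMod.toCofree_smul hC r φ)

/-- The canonical maps carry the failure of colinearity to the difference of the two maps `M ⊗ C ⇉
(M ⊗ C) ⊗ C`, which vanishes on `ρ(m)`. -/
theorem canMap_colinearDefect (hC : IsWeaklyLocallyProjective A C) (M : Comod A C)
    (z : BTensor R (LinMod ι M.carrier) (LeftMod ι)) :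
    canMap ι (BTensor A M.carrier C) (rTensor (LeftMod ι) (colinearDefect hC ι M)
      (colinearDefect_smul hC M) z) =
    rightTensor C M.coact (canMap ι M.carrier z) -
      cofreeCoact A C M.carrier (canMap ι M.carrier z) := by
  refine hom_congr (f := (canMap ι (BTensor A M.carrier C)).comp (rTensor (LeftMod ι)
    (colinearDefect hC ι M) (colinearDefect_smul hC M)))
    (g := (rightTensor C M.coact).comp (canMap ι M.carrier) -
      (cofreeCoact A C M.carrier).toAddMonoidHom.comp (canMap ι M.carrier)) (fun φ x => ?_) z
  obtain ⟨x, rfl⟩ : ∃ y, LeftMod.of ι y = x := ⟨x, rfl⟩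
  rw [AddMonoidHom.comp_apply, rTensor_tmul, canMap_tmul, AddMonoidHom.sub_apply,
    AddMonoidHom.comp_apply, AddMonoidHom.comp_apply, canMap_tmul, eq_sub_iff_add_eq]
  have h1 := Hom.colinear (Comod.toCofree hC (LinMod.toLin φ)) x
  refine (congrArg (fun t : BTensor A (BTensor A M.carrier C) C =>
    rightTensor C (LinMod.toLin (colinearDefect hC ι M φ)) (S.coact x) + t) h1.symm).trans ?_
  rw [← rightTensor_comp]
  refine (rightTensor_add _ _ _).symm.trans ?_
  congr 2
  refine LinearMap.ext fun y => ?_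
  exact sub_add_cancel _ _

/-- Write `ρ(m) = can(z)`. The canonical map for `M ⊗ C` is injective, so `z` is killed by the
defect; flatness keeps `0 → Hom^C(S, M) → Hom_A(S, M) → Hom_A(S, M ⊗ C)` exact, so `z` comes from
some `w` in `Hom^C(S, M) ⊗ S`. Then `ρ(ev w) = ρ(m)`, and the counit makes `ρ` injective. -/
theorem evMap_surjective_of_isFlatLeft_of_isComonadicGalois (hC : IsWeaklyLocallyProjective A C)
    (hflat : IsFlatLeft R (LeftMod ι)) (hgal : IsComonadicGalois ι) (M : Comod A C) :
    Function.Surjective (evMap ι M) := by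
  intro m
  obtain ⟨z, hz⟩ := (hgal M.carrier).2 (M.coact m)
  have hd : rTensor (LeftMod ι) (colinearDefect hC ι M) (colinearDefect_smul hC M) z = 0 := by
    refine (hgal (BTensor A M.carrier C)).1 ?_
    rw [canMap_colinearDefect, map_zero, hz, sub_eq_zero]
    have h1 := Hom.colinear (Comod.toCofree hC (LinearMap.id : M.carrier →ₗ[Aᵐᵒᵖ] M.carrier)) m
    have h2 : Hom.toLin (Comod.toCofree hC (LinearMap.id : M.carrier →ₗ[Aᵐᵒᵖ] M.carrier)) =
        M.coact := LinearMap.ext fun x => rightTensor_id _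
    rw [h2] at h1
    exact h1
  have hsmul : ∀ (r : R) φ, HomMod.toLinMod ι M (op r • φ) = op r • HomMod.toLinMod ι M φ :=
    fun _ _ => rfl
  have hex : Function.Exact (HomMod.toLinMod ι M) (colinearDefect hC ι M) := by
    intro φ
    constructor
    · intro h
      refine ⟨HomMod.of ι (homMk (LinMod.toLin φ) fun x => ?_), rfl⟩
      have h1 := colinearDefect_apply hC M φ x
      rw [h] at h1
      exact (sub_eq_zero.1 h1.symm).symm
    · rintro ⟨φ, rfl⟩
      refine LinearMap.ext fun x => (colinearDefect_apply hC M _ x).trans ?_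
      exact sub_eq_zero.2 (Hom.colinear φ.hom x).symm
  obtain ⟨w, hw⟩ := ((hflat _ _ _ (HomMod.toLinMod ι M) (colinearDefect hC ι M) hsmul
    (colinearDefect_smul hC M) (fun φ ψ h => Subtype.ext h) hex).2 z).1 hd
  have hcan : ∀ w, canMap ι M.carrier (rTensor (LeftMod ι) (HomMod.toLinMod ι M) hsmul w) =
      M.coact (evMap ι M w) := by
    refine hom_congr (f := (canMap ι M.carrier).comp
      (rTensor (LeftMod ι) (HomMod.toLinMod ι M) hsmul))
      (g := M.coact.toAddMonoidHom.comp (evMap ι M)) (fun φ x => ?_)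
    rw [AddMonoidHom.comp_apply, rTensor_tmul, canMap_tmul, AddMonoidHom.comp_apply, evMap_tmul]
    exact Hom.colinear φ.hom x
  refine ⟨w, ?_⟩
  have h1 : M.coact (evMap ι M w) = M.coact m := by rw [← hcan, hw, hz]
  rw [← M.act_counit (evMap ι M w), act, h1]
  exact M.act_counit m

end Descent

/-- Weak structure theorem for Galois comodules over a firm ring of coinvariants.
The last item says that `Q ⊗_R S → *C`, `q ⊗ x ↦ q(x)`, corestricts to a surjection onto
`Rat(*C)`. -/
theorem theorem3p5 {A C R : Type u} [Ring A] [AddCommGroup C] [Module A C] [Module Aᵐᵒᵖ C]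
    [SMulCommClass A Aᵐᵒᵖ C] [Coring A C]
    (hC : IsWeaklyLocallyProjective A C)
    (hdense : @Dense (C →ₗ[A] A) (finiteTopology A C) (ratDual A C))
    [NonUnitalRing R] (hR : IsFirmRing R)
    (S : Comod A C) (ι : R →ₙ+* End S)
    (hι : Function.Injective ι)
    (hideal : ∀ (r : R) (t : End S), ∃ r' : R, ι r' = ι r * t)
    (hS : IsFirmLeft R (LeftMod ι)) :
    List.TFAE [
      IsSeparator S,
      IsFlatLeft R (LeftMod ι) ∧ IsComonadicGalois ι,
      (coinvFunctor hR ι).Full ∧ (coinvFunctor hR ι).Faithful,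
      (moritaMap ι).range = (ratDual A C).toAddSubgroup] := by
  tfae_have 1 → 2 := fun h =>
    have hsurj := evMap_surjective_of_isSeparator hC ι h
    ⟨isFlatLeft_of_evMap_surjective hC hι hideal hS hsurj,
      isComonadicGalois_of_evMap_surjective hC hideal hS hsurj⟩
  tfae_have 2 → 1 := fun h => isSeparator_of_evMap_surjective ι
    (evMap_surjective_of_isFlatLeft_of_isComonadicGalois hC h.1 h.2)
  tfae_have 1 → 3 := fun h =>
    ⟨coinvFunctor_full hC hR hideal hS (evMap_surjective_of_isSeparator hC ι h),
      coinvFunctor_faithful hR hS h⟩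
  tfae_have 3 → 1 := fun h => isSeparator_of_faithful hR h.2
  tfae_have 1 → 4 := fun h =>
    range_moritaMap_of_evMap_surjective hC (evMap_surjective_of_isSeparator hC ι h)
  tfae_have 4 → 1 := fun h => isSeparator_of_evMap_surjective ι
    (evMap_surjective_of_range_moritaMap hC hdense h)
  tfae_finish
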